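/- **Conventions.** $\log$ is the natural logarithm. For $x\in\{0,1\}^n$, $|x|$ is the Hamming weight, and $x_T=(x_i)_{i\in T}$ for $T\subseteq[n]$. For distributions $P,Q$ on a finite set $\Omega$, $\Delta(P,Q)=\frac12\sum_{a\in\Omega}|P(a)-Q(a)|$ is the statistical distance. A DNF over $m$ bits of size at most $s$ and width at most $d$ is a disjunction of at most $s$ terms $[y_N=\beta]$ with $N\subseteq[m]$, $|N|\le d$, $\beta\in\{0,1\}^N$. A finite set system $\mathcal S$ with kernel $K=\bigcap_{S\in\mathcal S}S$ is a $(p,\varepsilon)$-robust sunflower if $K\notin\mathcal S$ and $\Pr_{\boldsymbol R}[\exists S\in\mathcal S:\ S\subseteq \boldsymbol R\cup K]\ge 1-\varepsilon$, where $\boldsymbol R$ contains each element of the (finite) universe independently with probability $p$. Call $B>0$ a *robust sunflower constant* if for all $p,\varepsilon\in(0,1/2]$ and all integers $d\ge1$, every family $\mathcal F$ of non-empty sets of size at most $d$ with $|\mathcal F|\ge d\,(B\log(d/\varepsilon)/p)^d$ contains a $(p,\varepsilon)$-robust sunflower. **Theorem.** A robust sunflower constant exists, and for every robust sunflower constant $B$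 the following holds. Let $m,s\ge 0$, $n\ge 2$, $d\ge 1$ be integers and $t\in[n]$. Let $\boldsymbol Y$ be uniform over $\{0,1\}^m$, and let $\boldsymbol X=X(\boldsymbol Y)$ be an $n$-bit source each of whose bits is computed from $\boldsymbol Y$ by a DNF of size at most $s$ and width at most $d$. Let $\alpha:\mathbb N\to\mathbb R$ be a function and let $\boldsymbol F$ be a distribution over $\{0,1\}^n$ such that - for every $T\subseteq[n]$ with $|T|\ge n/2$, $\Pr[\boldsymbol F_T=0^T]\le\alpha(n)$; - $\Pr[|\boldsymbol F|>t]\le\alpha(n)$. If $2d\cdot t\cdot(40Bt\log n)^d\le n$, then $$\Delta(\boldsymbol X,\boldsymbol F)\ \ge\ 1-2\alpha(n)-\frac1{2n}.$$ -/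

import Mathlib

/-- A conjunctive term over `m` input bits: the condition that the bits in `dom` agree with `val`.
The values of `val` outside `dom` play no role. -/
structure DNFTerm (m : ℕ) where
  dom : Finset (Fin m)
  val : Fin m → Bool

/-- The assignment `y` satisfies the term `τ`. A term with empty domain is always satisfied. -/
def DNFTerm.Sat {m : ℕ} (τ : DNFTerm m) (y : Fin m → Bool) : Prop :=
  ∀ i ∈ τ.dom, y i = τ.val i

/-- The Boolean function `f` is computed by a DNF that has at most `s` terms, each of them with at
most `d` literals. The empty DNF is the constant `false`. -/
def ComputedByDNF {m : ℕ} (s d : ℕ) (f : (Fin m → Bool) → Bool) : Prop :=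
  ∃ φ : List (DNFTerm m), φ.length ≤ s ∧ (∀ τ ∈ φ, τ.dom.card ≤ d) ∧
    ∀ y, f y = true ↔ ∃ τ ∈ φ, τ.Sat y

/-- The probability of the event `E` under the distribution `P`. -/
noncomputable def prob {Ω : Type*} (P : PMF Ω) (E : Set Ω) : ℝ :=
  (P.toOuterMeasure E).toReal

/-- The statistical distance `½ ∑ a, |P(a) - Q(a)|`. -/
noncomputable def statDist {Ω : Type*} [Fintype Ω] (P Q : PMF Ω) : ℝ :=
  (1 / 2) * ∑ a, |(P a).toReal - (Q a).toReal|

/-- The distribution of `X(Y)`, where `Y` is uniform over `{0,1}^m`. -/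
noncomputable def sourceLaw {m n : ℕ} (X : (Fin m → Bool) → (Fin n → Bool)) :
    PMF (Fin n → Bool) :=
  (PMF.uniformOfFintype (Fin m → Bool)).map X

/-- The Hamming weight of a bit string. -/
def hammingWeight {n : ℕ} (x : Fin n → Bool) : ℕ :=
  (Finset.univ.filter fun i => x i = true).card

open Classical in
/-- The probability of the event `E` for a random subset of `α` that contains every element
independently with probability `p`. -/
noncomputable def randomSubsetProb {α : Type*} [Fintype α] (p : ℝ) (E : Finset α → Prop) : ℝ :=
  ∑ R ∈ Finset.univ.filter E, p ^ R.card * (1 - p) ^ Rᶜ.card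

/-- The kernel of a set system: the intersection of all its members. -/
def sunflowerKernel {α : Type*} [Fintype α] [DecidableEq α] (S : Finset (Finset α)) : Finset α :=
  S.inf id

/-- `S` is a `(p, ε)`-robust sunflower: its kernel `K` is not a member, and with probability at
least `1 - ε` some member is contained in `R ∪ K`, where every element of the universe is in `R`
independently with probability `p`. -/
def IsRobustSunflower {α : Type*} [Fintype α] [DecidableEq α] (p ε : ℝ)
    (S : Finset (Finset α)) : Prop :=
  sunflowerKernel S ∉ S ∧
    1 - ε ≤ randomSubsetProb p (fun R : Finset α => ∃ N ∈ S, N ⊆ R ∪ sunflowerKernel S)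

/-- `B` is a constant for the robust sunflower lemma: for all `p, ε ∈ (0, 1/2]` and `d ≥ 1`, every
family of at least `d (B log (d/ε) / p)^d` non-empty sets of size at most `d` contains a
`(p, ε)`-robust sunflower. -/
def IsRobustSunflowerConstant (B : ℝ) : Prop :=
  0 < B ∧
    ∀ (α : Type) [Fintype α] [DecidableEq α] (p ε : ℝ) (d : ℕ) (𝓕 : Finset (Finset α)),
      0 < p → p ≤ 1 / 2 → 0 < ε → ε ≤ 1 / 2 → 1 ≤ d →
      (∀ N ∈ 𝓕, N.Nonempty ∧ N.card ≤ d) →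
      (d : ℝ) * (B * Real.log ((d : ℝ) / ε) / p) ^ d ≤ (𝓕.card : ℝ) →
      ∃ S, S ⊆ 𝓕 ∧ IsRobustSunflower p ε S

/-!
# Width-bounded DNF sources are far from distributions with few but spread-out ones

**Existence of a robust sunflower constant.** A family of sets is `r`-spread if a random member
contains a set `Z` with probability at most `r ^ (-|Z|)`. Expose a random set `W` of density `p` and
replace every member by its minimum fragment, a smallest set `A j \ W` among the members `A j`
contained in `W ∪ A i` and no larger than `A i`. A pair `(W, i)` whose fragment `T` has size `t` is
determined by `W ∪ T`, by `T`, which is a subset of a member depending on `W ∪ T` only, and by `i`,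
for which spreadness leaves a fraction `r ^ (-t)` of the indices. Hence fragments of more than half
the original size are rare as soon as `p * r` is a large constant, and one exposure shrinks the
average size by a constant factor (`IsMinFragment.sum_card_le`). If no member has been completed,
then the average size is at least one. After about `log (d / ε)` rounds this has probability at most
`ε` (`IsSpread.one_sub_le_randomSubsetProb`). A large family contains a spread link, which gives the
robust sunflower (`exists_isRobustSunflowerConstant`).

**The lower bound.** Let `G` be the set of inputs on which the source has weight at most `t`. It
suffices to find a set `T` of half of the outputs such that an input is in `G` and makes some output
in `T` equal to one with probability at most `1 / 2n`: the event that the weight exceeds `t` or all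
outputs in `T` vanish then distinguishes the source from `F`. Terms are partial assignments. Call a
partial assignment avoided if, conditioned on agreeing with it, an input is in `G` only with small
probability.

* If more than half of the outputs had a term that contains no avoided partial assignment, then such
  terms would contain a sunflower. Colouring the variables with `t + 1` colours shows that an input
  agreeing with the core of the sunflower satisfies more than `t` of the terms with high
  probability, so the core would be avoided (`two_mul_card_unavoided_le`). Let `T` be the set of the
  other outputs.
* If an input makes an output in `T` equal to one, then it agrees with a minimal avoided partial
  assignment. A union bound over these does not depend on the number of terms: too many minimal
  avoided partial assignments of the same size would contain a sunflower whose core, a smaller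
  partial assignment, is avoided too (`card_minimal_isAvoided_le`). For this to hold, the
  probability allowed in the definition of avoided grows as the size decreases.

To apply the robust sunflower lemma to partial assignments, fix a total assignment `x` that agrees
with many of them (`exists_common_assignment`). The coordinates at which a uniform assignment
agrees with `x` form a uniformly random set.
-/

/-! ### Random subsets -/

open Finset in
/-- The probability that the random subset of `V` containing every element independently with
probability `p` is equal to `R`. -/
noncomputable def subsetWeight {V : Type*} [Fintype V] (p : ℝ) (R : Finset V) : ℝ :=
  p ^ #R * (1 - p) ^ (Fintype.card V - #R)

theorem randomSubsetProb_eq_sum {V : Type*} [Fintype V] (p : ℝ) (E : Finset V → Prop)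
    [DecidablePred E] :
    randomSubsetProb p E = ∑ R, if E R then subsetWeight p R else 0 := by
  classical
  unfold randomSubsetProb subsetWeight
  rw [Finset.sum_filter]
  refine Finset.sum_congr rfl fun R _ => ?_
  rw [Finset.card_compl]
  congr

theorem subsetWeight_nonneg {V : Type*} [Fintype V] {p : ℝ} (h0 : 0 ≤ p) (h1 : p ≤ 1)
    (R : Finset V) : 0 ≤ subsetWeight p R :=
  mul_nonneg (pow_nonneg h0 _) (pow_nonneg (by linarith) _)

theorem sum_subsetWeight {V : Type*} [Fintype V] (p : ℝ) :
    ∑ R : Finset V, subsetWeight p R = 1 := by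
  unfold subsetWeight
  rw [Fintype.sum_pow_mul_eq_add_pow]
  simp

theorem subsetWeight_sdiff_le {V : Type*} [Fintype V] [DecidableEq V] {p : ℝ} (h0 : 0 < p)
    (h1 : p ≤ 1) {Z T : Finset V} (hT : T ⊆ Z) :
    subsetWeight p (Z \ T) ≤ subsetWeight p Z * (p⁻¹) ^ T.card := by
  unfold subsetWeight
  have hZ := Finset.card_le_univ Z
  have hTZ := Finset.card_le_card hT
  rw [Finset.card_sdiff_of_subset hT]
  have e1 : Fintype.card V - (Z.card - T.card) = (Fintype.card V - Z.card) + T.card := by omega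
  have e2 : p ^ (Z.card - T.card) = p ^ Z.card * (p⁻¹) ^ T.card := by
    conv_rhs => rw [← Nat.sub_add_cancel hTZ, pow_add]
    rw [mul_assoc, ← mul_pow, mul_inv_cancel₀ h0.ne', one_pow, mul_one]
  rw [e1, e2, pow_add]
  have h2 : (1 - p) ^ T.card ≤ 1 := pow_le_one₀ (by linarith) (by linarith)
  have h3 : 0 ≤ (1 - p) ^ (Fintype.card V - Z.card) := pow_nonneg (by linarith) _
  have h4 : 0 ≤ p ^ Z.card * p⁻¹ ^ T.card := by positivity
  calc _ ≤ p ^ Z.card * p⁻¹ ^ T.card * ((1 - p) ^ (Fintype.card V - Z.card) * 1) := by gcongr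
    _ = _ := by ring

/-- The union of two independent random subsets of densities `p` and `q` is a random subset of
density `p + q - pq`. -/
theorem sum_subsetWeight_union {V : Type*} [Fintype V] [DecidableEq V] (p q : ℝ)
    (f : Finset V → ℝ) :
    ∑ W, subsetWeight p W * ∑ U, subsetWeight q U * f (W ∪ U) =
      ∑ Z, subsetWeight (1 - (1 - p) * (1 - q)) Z * f Z := by
  have key : ∀ Z : Finset V, ∑ W, subsetWeight p W *
      (∑ U, if W ∪ U = Z then subsetWeight q U else 0) =
      subsetWeight (1 - (1 - p) * (1 - q)) Z := by
    intro Z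
    have inner : ∀ W : Finset V, (∑ U, if W ∪ U = Z then subsetWeight q U else 0) =
        if W ⊆ Z then q ^ (Z.card - W.card) * (1 - q) ^ (Fintype.card V - Z.card) else 0 := by
      intro W
      split_ifs with hW
      · rw [← Finset.sum_filter]
        have hb : ∑ U with W ∪ U = Z, subsetWeight q U =
            ∑ U ∈ W.powerset, subsetWeight q ((Z \ W) ∪ U) := by
          refine Finset.sum_nbij' (fun U => U ∩ W) (fun U => (Z \ W) ∪ U) ?_ ?_ ?_ ?_ ?_
          · intro U _; simp
          · intro U hU
            simp only [Finset.mem_powerset] at hU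
            simp only [Finset.mem_filter, Finset.mem_univ, true_and]
            ext x; have := @hU x; have := @hW x; grind
          · intro U hU
            simp only [Finset.mem_filter, Finset.mem_univ, true_and] at hU
            subst hU; grind
          · intro U hU
            simp only [Finset.mem_powerset] at hU
            ext x; have := @hU x; grind
          · intro U hU
            simp only [Finset.mem_filter, Finset.mem_univ, true_and] at hU
            subst hU; congr 1; grind
        rw [hb]
        have hc : ∀ U ∈ W.powerset, subsetWeight q ((Z \ W) ∪ U) =
            q ^ (Z.card - W.card) * (1 - q) ^ (Fintype.card V - Z.card) *
              (q ^ U.card * (1 - q) ^ (W.card - U.card)) := by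
          intro U hU
          simp only [Finset.mem_powerset] at hU
          have hd : Disjoint (Z \ W) U :=
            Finset.disjoint_of_subset_right hU Finset.sdiff_disjoint
          unfold subsetWeight
          rw [Finset.card_union_of_disjoint hd, Finset.card_sdiff_of_subset hW]
          have h1 := Finset.card_le_card hW
          have h2 := Finset.card_le_card hU
          have h3 := Finset.card_le_univ Z
          have e : Fintype.card V - (Z.card - W.card + U.card) =
            (Fintype.card V - Z.card) + (W.card - U.card) := by omega
          rw [e, pow_add, pow_add]; ring
        rw [Finset.sum_congr rfl hc, ← Finset.mul_sum, Finset.sum_pow_mul_eq_add_pow]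
        simp
      · refine Finset.sum_eq_zero fun U _ => ?_
        rw [if_neg]
        rintro rfl
        exact hW Finset.subset_union_left
    simp_rw [inner, mul_ite, mul_zero]
    rw [← Finset.sum_filter]
    have hf : (Finset.univ.filter fun W : Finset V => W ⊆ Z) = Z.powerset := by
      ext; simp
    rw [hf]
    have hc : ∀ W ∈ Z.powerset, subsetWeight p W *
        (q ^ (Z.card - W.card) * (1 - q) ^ (Fintype.card V - Z.card)) =
        ((1 - p) * (1 - q)) ^ (Fintype.card V - Z.card) *
          (p ^ W.card * ((1 - p) * q) ^ (Z.card - W.card)) := by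
      intro W hW
      simp only [Finset.mem_powerset] at hW
      unfold subsetWeight
      have h1 := Finset.card_le_card hW
      have h3 := Finset.card_le_univ Z
      have e : Fintype.card V - W.card =
        (Fintype.card V - Z.card) + (Z.card - W.card) := by omega
      rw [e, pow_add, mul_pow, mul_pow]; ring
    rw [Finset.sum_congr rfl hc, ← Finset.mul_sum, Finset.sum_pow_mul_eq_add_pow]
    unfold subsetWeight
    rw [show p + (1 - p) * q = 1 - (1 - p) * (1 - q) by ring]
    ring
  calc ∑ W, subsetWeight p W * ∑ U, subsetWeight q U * f (W ∪ U)
      = ∑ W, ∑ Z, subsetWeight p W *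
          (∑ U, if W ∪ U = Z then subsetWeight q U else 0) * f Z := by
        refine Finset.sum_congr rfl fun W _ => ?_
        simp_rw [mul_assoc, ← Finset.mul_sum, Finset.sum_mul]
        rw [Finset.sum_comm]
        congr 1
        refine Finset.sum_congr rfl fun U _ => ?_
        simp
    _ = ∑ Z, subsetWeight (1 - (1 - p) * (1 - q)) Z * f Z := by
        rw [Finset.sum_comm]
        refine Finset.sum_congr rfl fun Z _ => ?_
        rw [← Finset.sum_mul, key]

/-! ### Minimum fragments in spread families -/

open Finset in
/-- An indexed family of finite sets is `r`-spread if a uniformly random member contains a given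
set `Z` with probability at most `r ^ (-|Z|)`. -/
def IsSpread {V ι : Type*} [DecidableEq V] [Fintype ι] (r : ℝ) (A : ι → Finset V) : Prop :=
  ∀ Z : Finset V, (#{i | Z ⊆ A i} : ℝ) * r ^ #Z ≤ Fintype.card ι

open Finset in
/-- `T W i` is a minimum fragment of `A i` relative to `W`: a set `A j \ W` of least cardinality
among those with `A j ⊆ W ∪ A i` and `|A j| ≤ |A i|`. -/
def IsMinFragment {V ι : Type*} [DecidableEq V] (A : ι → Finset V)
    (T : Finset V → ι → Finset V) : Prop :=
  ∀ W i, (∃ j, #(A j) ≤ #(A i) ∧ A j ⊆ W ∪ A i ∧ T W i = A j \ W) ∧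
    ∀ j, #(A j) ≤ #(A i) → A j ⊆ W ∪ A i → #(T W i) ≤ #(A j \ W)

theorem exists_isMinFragment {V ι : Type*} [DecidableEq V] [Fintype ι] (A : ι → Finset V) :
    ∃ T, IsMinFragment A T := by
  classical
  have h : ∀ W i, ∃ U : Finset V,
      (∃ j, (A j).card ≤ (A i).card ∧ A j ⊆ W ∪ A i ∧ U = A j \ W) ∧
      ∀ j, (A j).card ≤ (A i).card → A j ⊆ W ∪ A i → U.card ≤ (A j \ W).card := by
    intro W i
    obtain ⟨j, hj, hmin⟩ := Finset.exists_min_image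
      (Finset.univ.filter fun j => (A j).card ≤ (A i).card ∧ A j ⊆ W ∪ A i)
      (fun j => (A j \ W).card) ⟨i, by simp⟩
    simp only [Finset.mem_filter, Finset.mem_univ, true_and] at hj hmin
    exact ⟨A j \ W, ⟨j, hj.1, hj.2, rfl⟩, fun k h1 h2 => hmin k ⟨h1, h2⟩⟩
  choose T hT using h
  exact ⟨T, hT⟩

theorem IsMinFragment.subset {V ι : Type*} [DecidableEq V] {A : ι → Finset V}
    {T : Finset V → ι → Finset V}
    (hT : IsMinFragment A T) (W : Finset V) (i : ι) : T W i ⊆ A i := by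
  obtain ⟨j, -, hj, e⟩ := (hT W i).1
  rw [e]
  intro x hx
  have := @hj x
  grind

theorem IsMinFragment.disjoint {V ι : Type*} [DecidableEq V] {A : ι → Finset V}
    {T : Finset V → ι → Finset V}
    (hT : IsMinFragment A T) (W : Finset V) (i : ι) : Disjoint (T W i) W := by
  obtain ⟨j, -, -, e⟩ := (hT W i).1
  rw [e]
  exact Finset.sdiff_disjoint

theorem IsSpread.mono {V ι : Type*} [DecidableEq V] [Fintype ι] {r : ℝ} (hr : 0 ≤ r)
    {A A' : ι → Finset V} (hA : IsSpread r A) (h : ∀ i, A' i ⊆ A i) : IsSpread r A' := by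
  intro Z
  refine le_trans ?_ (hA Z)
  refine mul_le_mul_of_nonneg_right ?_ (pow_nonneg hr _)
  exact_mod_cast Finset.card_le_card
    (Finset.monotone_filter_right _ fun i _ hz => Finset.Subset.trans hz (h i))

theorem card_le_sum_card_of_nonempty {V ι : Type*} [Fintype ι] {A : ι → Finset V}
    (h : ∀ i, (A i).Nonempty) :
    (Fintype.card ι : ℝ) ≤ ∑ i, ((A i).card : ℝ) := by
  rw [← Finset.card_univ, ← nsmul_one, ← Finset.sum_const]
  refine Finset.sum_le_sum fun i _ => ?_
  exact_mod_cast (h i).card_pos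

section Fragments

variable {V ι : Type*} [Fintype V] [DecidableEq V] [Fintype ι]

/-- Pairs `(W, i)` with a fragment of size `t` are rare: such a pair is determined by the union
`Z = W ∪ T W i`, the fragment, which is one of at most `2 ^ a` subsets of a member of the family
depending on `Z` only, and the index `i`, for which spreadness leaves few choices. -/
theorem IsMinFragment.sum_weight_le {A : ι → Finset V} {T : Finset V → ι → Finset V}
    (hT : IsMinFragment A T) {p r : ℝ} (hp0 : 0 < p) (hp1 : p ≤ 1) (hr : 0 < r)
    (hA : IsSpread r A) (a t : ℕ) :
    ∑ W, ∑ i, (if (A i).card = a ∧ (T W i).card = t then subsetWeight p W else 0) ≤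
      2 ^ a * (p * r)⁻¹ ^ t * Fintype.card ι := by
  classical
  -- `C Z` is a member of size at most `a` contained in `Z`, if there is one. By minimality of the
  -- fragment, `C (W ∪ T W i) \ W` is equal to `T W i`.
  have hC : ∀ Z : Finset V, ∃ C : Finset V, C.card ≤ a ∧
      ((∃ j, (A j).card ≤ a ∧ A j ⊆ Z) → ∃ j, (A j).card ≤ a ∧ A j ⊆ Z ∧ C = A j) := by
    intro Z
    by_cases h : ∃ j, (A j).card ≤ a ∧ A j ⊆ Z
    · obtain ⟨j, h1, h2⟩ := h
      exact ⟨A j, h1, fun _ => ⟨j, h1, h2, rfl⟩⟩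
    · exact ⟨∅, by simp, fun h' => absurd h' h⟩
  choose C hCa hC using hC
  set S : Finset (Finset V × ι) :=
    Finset.univ.filter fun x => (A x.2).card = a ∧ (T x.1 x.2).card = t with hS
  set g : Finset V × ι → Finset V × Finset V × ι :=
    fun x => (x.1 ∪ T x.1 x.2, T x.1 x.2, x.2) with hg
  have hback : ∀ x : Finset V × ι, (g x).1 \ (g x).2.1 = x.1 := by
    intro x
    have := hT.disjoint x.1 x.2
    simp only [hg]
    rw [Finset.union_sdiff_right]
    exact Finset.sdiff_eq_self_of_disjoint this.symm
  have hinj : Set.InjOn g S := by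
    intro x _ y _ hxy
    refine Prod.ext ?_ ?_
    · rw [← hback x, ← hback y, hxy]
    · exact congrArg (fun z => z.2.2) hxy
  set Y : Finset (Finset V × Finset V × ι) := Finset.univ.filter fun y =>
    (y.2.1 ⊆ C y.1 ∧ y.2.1.card = t ∧ y.2.1 ⊆ y.1) ∧ y.2.1 ⊆ A y.2.2 with hY
  have hSY : S.image g ⊆ Y := by
    intro y hy
    obtain ⟨x, hx, rfl⟩ := Finset.mem_image.1 hy
    obtain ⟨W, i⟩ := x
    simp only [hS, Finset.mem_filter, Finset.mem_univ, true_and] at hx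
    simp only [hY, hg, Finset.mem_filter, Finset.mem_univ, true_and]
    refine ⟨⟨?_, hx.2, Finset.subset_union_right⟩, hT.subset W i⟩
    obtain ⟨⟨j, hj1, hj2, hj3⟩, hmin⟩ := hT W i
    obtain ⟨k, hk1, hk2, hk3⟩ := hC (W ∪ T W i) ⟨j, hx.1 ▸ hj1, by rw [hj3]; simp⟩
    have hsub : A k \ W ⊆ T W i := by
      intro v hv; have := @hk2 v; grind
    have hk4 : A k ⊆ W ∪ A i :=
      hk2.trans (Finset.union_subset_union_right (hT.subset W i))
    have := Finset.eq_of_subset_of_card_le hsub (hmin k (hx.1.symm ▸ hk1) hk4)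
    rw [hk3, ← this]
    exact Finset.sdiff_subset
  have h1 : ∑ W, ∑ i, (if (A i).card = a ∧ (T W i).card = t then subsetWeight p W else 0) =
      ∑ y ∈ S.image g, subsetWeight p (y.1 \ y.2.1) := by
    rw [Finset.sum_image hinj, ← Fintype.sum_prod_type', ← Finset.sum_filter]
    refine Finset.sum_congr rfl fun x _ => ?_
    rw [hback]
  rw [h1]
  calc ∑ y ∈ S.image g, subsetWeight p (y.1 \ y.2.1)
      ≤ ∑ y ∈ Y, subsetWeight p (y.1 \ y.2.1) :=
        Finset.sum_le_sum_of_subset_of_nonneg hSY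
          fun y _ _ => subsetWeight_nonneg hp0.le hp1 _
    _ ≤ ∑ y ∈ Y, subsetWeight p y.1 * p⁻¹ ^ t := by
        refine Finset.sum_le_sum fun y hy => ?_
        simp only [hY, Finset.mem_filter, Finset.mem_univ, true_and] at hy
        rw [← hy.1.2.1]
        exact subsetWeight_sdiff_le hp0 hp1 hy.1.2.2
    _ = ∑ Z, ∑ U, if U ⊆ C Z ∧ U.card = t ∧ U ⊆ Z then
          subsetWeight p Z * p⁻¹ ^ t * ((Finset.univ.filter fun i => U ⊆ A i).card : ℝ)
          else 0 := by
        rw [hY, Finset.sum_filter, Fintype.sum_prod_type]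
        refine Finset.sum_congr rfl fun Z _ => ?_
        rw [Fintype.sum_prod_type]
        refine Finset.sum_congr rfl fun U _ => ?_
        by_cases h : U ⊆ C Z ∧ U.card = t ∧ U ⊆ Z
        · simp only [h, true_and, and_self, if_true]
          rw [← Finset.sum_filter, Finset.sum_const, nsmul_eq_mul, mul_comm]
        · simp [h]
    _ ≤ ∑ Z, ∑ U ∈ (C Z).powerset,
          subsetWeight p Z * p⁻¹ ^ t * (r⁻¹ ^ t * Fintype.card ι) := by
        refine Finset.sum_le_sum fun Z _ => ?_
        rw [← Finset.sum_filter]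
        refine le_trans (Finset.sum_le_sum (g := fun U =>
          subsetWeight p Z * p⁻¹ ^ t * (r⁻¹ ^ t * Fintype.card ι)) fun U hU => ?_) ?_
        · simp only [Finset.mem_filter, Finset.mem_univ, true_and] at hU
          have h2 := hA U
          rw [hU.2.1] at h2
          have hw := subsetWeight_nonneg hp0.le hp1 Z
          gcongr
          rw [inv_pow, inv_mul_eq_div, le_div_iff₀ (by positivity)]
          exact h2
        · refine Finset.sum_le_sum_of_subset_of_nonneg ?_ fun U _ _ => ?_
          · intro U hU
            simp only [Finset.mem_filter, Finset.mem_univ, true_and] at hU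
            exact Finset.mem_powerset.2 hU.1
          · have hw := subsetWeight_nonneg hp0.le hp1 Z
            positivity
    _ ≤ ∑ Z, subsetWeight p Z * (2 ^ a * (p * r)⁻¹ ^ t * Fintype.card ι) := by
        refine Finset.sum_le_sum fun Z _ => ?_
        rw [Finset.sum_const, Finset.card_powerset, nsmul_eq_mul]
        have hw := subsetWeight_nonneg hp0.le hp1 Z
        have h2 : ((2 ^ (C Z).card : ℕ) : ℝ) ≤ 2 ^ a := by
          push_cast
          exact pow_le_pow_right₀ (by norm_num) (hCa Z)
        calc _ ≤ 2 ^ a * (subsetWeight p Z * p⁻¹ ^ t * (r⁻¹ ^ t * Fintype.card ι)) := by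
              gcongr
          _ = _ := by rw [mul_inv, mul_pow]; ring
    _ = _ := by rw [← Finset.sum_mul, sum_subsetWeight, one_mul]

theorem sum_eighth_pow_le (N : ℕ) : ∑ t ∈ Finset.range N, (1 / 8 : ℝ) ^ (t + 1) ≤ 1 / 4 := by
  have h : ∀ N : ℕ, ∑ t ∈ Finset.range N, (1 / 8 : ℝ) ^ (t + 1) = 1 / 7 - 1 / 7 * (1 / 8) ^ N := by
    intro N
    induction N with
    | zero => simp
    | succ k ih => rw [Finset.sum_range_succ, ih]; ring
  rw [h]
  have : (0 : ℝ) ≤ (1 / 8) ^ N := by positivity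
  linarith

/-- One round of random exposure shrinks the average size of the sets by a constant factor. -/
theorem IsMinFragment.sum_card_le {A : ι → Finset V} {T : Finset V → ι → Finset V}
    (hT : IsMinFragment A T) {p r : ℝ} (hp0 : 0 < p) (hp1 : p ≤ 1) (hr : 0 < r)
    (hA : IsSpread r A) (hpr : 256 ≤ p * r) :
    ∑ W, subsetWeight p W * ∑ i, ((T W i).card : ℝ) ≤ 3 / 4 * ∑ i, ((A i).card : ℝ) := by
  classical
  by_cases hne : ∃ j, A j = ∅
  · obtain ⟨j, hj⟩ := hne
    -- An empty member makes all fragments empty.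
    have h0 : ∀ W i, (T W i).card = 0 := by
      intro W i
      have := (hT W i).2 j (by simp [hj]) (by simp [hj])
      simpa [hj] using this
    simp only [h0]
    simp only [Nat.cast_zero, Finset.sum_const_zero, mul_zero]
    positivity
  push Not at hne
  set N := Fintype.card V
  -- A fragment either has at most half the size of its set or is one of the rare large ones.
  have hpt : ∀ W i, ((T W i).card : ℝ) ≤ 1 / 2 * (A i).card +
      ∑ t ∈ Finset.range N, ∑ a ∈ Finset.range (2 * (t + 1)),
        if (A i).card = a ∧ (T W i).card = t + 1 then ((t + 1 : ℕ) : ℝ) else 0 := by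
    intro W i
    by_cases hs : (A i).card < 2 * (T W i).card
    · have hpos : 0 < (T W i).card := by omega
      have hN : (T W i).card ≤ N := Finset.card_le_univ _
      obtain ⟨t, ht⟩ : ∃ t, (T W i).card = t + 1 := ⟨(T W i).card - 1, by omega⟩
      have h1 : ((T W i).card : ℝ) ≤ ∑ t ∈ Finset.range N, ∑ a ∈ Finset.range (2 * (t + 1)),
          if (A i).card = a ∧ (T W i).card = t + 1 then ((t + 1 : ℕ) : ℝ) else 0 := by
        refine le_trans ?_ (Finset.single_le_sum (f := fun t =>
          ∑ a ∈ Finset.range (2 * (t + 1)),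
            if (A i).card = a ∧ (T W i).card = t + 1 then ((t + 1 : ℕ) : ℝ) else 0)
          (fun t _ => Finset.sum_nonneg fun a _ => by split_ifs <;> positivity)
          (Finset.mem_range.2 (show t < N by omega)))
        refine le_trans ?_ (Finset.single_le_sum (f := fun a =>
            if (A i).card = a ∧ (T W i).card = t + 1 then ((t + 1 : ℕ) : ℝ) else 0)
          (fun a _ => by split_ifs <;> positivity)
          (Finset.mem_range.2 (show (A i).card < 2 * (t + 1) by omega)))
        simp [ht]
      have : (0 : ℝ) ≤ 1 / 2 * (A i).card := by positivity
      linarith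
    · have h1 : (2 : ℝ) * (T W i).card ≤ (A i).card := by exact_mod_cast not_lt.1 hs
      have h2 : (0 : ℝ) ≤ ∑ t ∈ Finset.range N, ∑ a ∈ Finset.range (2 * (t + 1)),
          if (A i).card = a ∧ (T W i).card = t + 1 then ((t + 1 : ℕ) : ℝ) else 0 :=
        Finset.sum_nonneg fun t _ => Finset.sum_nonneg fun a _ => by split_ifs <;> positivity
      linarith
  -- Large fragments of size `t` have total mass at most `2 t² (4 / 256) ^ t ≤ 8 ^ (-t)`.
  have hlarge : ∑ W, subsetWeight p W * ∑ i, ∑ t ∈ Finset.range N,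
      ∑ a ∈ Finset.range (2 * (t + 1)),
        (if (A i).card = a ∧ (T W i).card = t + 1 then ((t + 1 : ℕ) : ℝ) else 0) ≤
      1 / 4 * Fintype.card ι := by
    have e : ∑ W, subsetWeight p W * ∑ i, ∑ t ∈ Finset.range N,
        ∑ a ∈ Finset.range (2 * (t + 1)),
          (if (A i).card = a ∧ (T W i).card = t + 1 then ((t + 1 : ℕ) : ℝ) else 0) =
        ∑ t ∈ Finset.range N, ∑ a ∈ Finset.range (2 * (t + 1)), ((t + 1 : ℕ) : ℝ) *
          ∑ W, ∑ i, (if (A i).card = a ∧ (T W i).card = t + 1 then subsetWeight p W else 0) := by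
      simp_rw [Finset.mul_sum]
      rw [Finset.sum_comm' (t' := Finset.univ) (s' := fun _ => Finset.univ) (by simp)]
      rw [Finset.sum_congr rfl fun i _ => Finset.sum_comm]
      rw [Finset.sum_comm]
      refine Finset.sum_congr rfl fun t _ => ?_
      rw [Finset.sum_congr rfl fun i _ => Finset.sum_comm]
      rw [Finset.sum_comm]
      refine Finset.sum_congr rfl fun a _ => ?_
      rw [Finset.sum_comm]
      refine Finset.sum_congr rfl fun i _ => Finset.sum_congr rfl fun W _ => ?_
      split_ifs <;> ring
    rw [e]
    have hx : (p * r)⁻¹ ≤ 1 / 256 := by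
      rw [inv_le_comm₀ (by linarith) (by norm_num)]; norm_num; exact hpr
    have hx0 : 0 ≤ (p * r)⁻¹ := by positivity
    calc _ ≤ ∑ t ∈ Finset.range N, (1 / 8 : ℝ) ^ (t + 1) * Fintype.card ι := by
          refine Finset.sum_le_sum fun t _ => ?_
          calc _ ≤ ∑ a ∈ Finset.range (2 * (t + 1)), ((t + 1 : ℕ) : ℝ) *
                (4 ^ (t + 1) * (1 / 256) ^ (t + 1) * Fintype.card ι) := by
                refine Finset.sum_le_sum fun a ha => ?_
                have h1 := hT.sum_weight_le hp0 hp1 hr hA a (t + 1)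
                have h2 : (2 : ℝ) ^ a ≤ 4 ^ (t + 1) := by
                  rw [show (4 : ℝ) = 2 ^ 2 by norm_num, ← pow_mul]
                  exact pow_le_pow_right₀ (by norm_num) (Finset.mem_range.1 ha).le
                refine mul_le_mul_of_nonneg_left (h1.trans ?_) (by positivity)
                gcongr
            _ = (2 * ((t + 1 : ℕ) : ℝ) ^ 2) * (1 / 64) ^ (t + 1) * Fintype.card ι := by
                rw [Finset.sum_const, Finset.card_range, nsmul_eq_mul]
                rw [show (1 / 64 : ℝ) = 4 * (1 / 256) by norm_num, mul_pow]
                push_cast; ring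
            _ ≤ 8 ^ (t + 1) * (1 / 64) ^ (t + 1) * Fintype.card ι := by
                have h3 : ∀ t : ℕ, 2 * (((t + 1 : ℕ) : ℝ)) ^ 2 ≤ 8 ^ (t + 1) := by
                  intro t
                  induction t with
                  | zero => norm_num
                  | succ k ih =>
                    have h4 : (0 : ℝ) ≤ k := by positivity
                    have h5 : 2 * (((k + 1 + 1 : ℕ) : ℝ)) ^ 2 ≤ 8 * (2 * ((k + 1 : ℕ) : ℝ) ^ 2) := by
                      push_cast; nlinarith
                    rw [pow_succ (8 : ℝ)]
                    linarith
                gcongr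
                exact h3 t
            _ = _ := by rw [← mul_pow]; norm_num
      _ = (∑ t ∈ Finset.range N, (1 / 8 : ℝ) ^ (t + 1)) * Fintype.card ι := by
          rw [Finset.sum_mul]
      _ ≤ _ := by gcongr; exact sum_eighth_pow_le N
  have hcard := card_le_sum_card_of_nonempty hne
  calc ∑ W, subsetWeight p W * ∑ i, ((T W i).card : ℝ)
      ≤ ∑ W, subsetWeight p W * ∑ i, (1 / 2 * ((A i).card : ℝ) +
        ∑ t ∈ Finset.range N, ∑ a ∈ Finset.range (2 * (t + 1)),
        if (A i).card = a ∧ (T W i).card = t + 1 then ((t + 1 : ℕ) : ℝ) else 0) := by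
        refine Finset.sum_le_sum fun W _ => mul_le_mul_of_nonneg_left
          (Finset.sum_le_sum fun i _ => hpt W i) (subsetWeight_nonneg hp0.le hp1 W)
    _ = 1 / 2 * ∑ i, ((A i).card : ℝ) + ∑ W, subsetWeight p W * ∑ i, ∑ t ∈ Finset.range N,
      ∑ a ∈ Finset.range (2 * (t + 1)),
        (if (A i).card = a ∧ (T W i).card = t + 1 then ((t + 1 : ℕ) : ℝ) else 0) := by
        simp_rw [Finset.sum_add_distrib, mul_add]
        rw [Finset.sum_add_distrib, ← Finset.sum_mul, sum_subsetWeight, one_mul, Finset.mul_sum]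
    _ ≤ _ := by linarith

/-- If every exposure round has density `p` with `p * r ≥ 256`, then after `l` rounds the random
set fails to contain a member of an `r`-spread family with probability at most `(3 / 4) ^ l` times
the average size of a member. -/
theorem IsSpread.sum_fail_le {p r : ℝ} (hp0 : 0 < p) (hp1 : p ≤ 1) (hr : 0 < r)
    (hpr : 256 ≤ p * r) (l : ℕ) :
    ∀ A : ι → Finset V, IsSpread r A →
      (∑ W, subsetWeight (1 - (1 - p) ^ l) W * (if ∃ i, A i ⊆ W then 0 else 1)) *
        Fintype.card ι ≤ (3 / 4) ^ l * ∑ i, ((A i).card : ℝ) := by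
  classical
  induction l with
  | zero =>
    intro A _
    have hw : ∀ W : Finset V, subsetWeight (1 - (1 - p) ^ 0) W = if W = ∅ then 1 else 0 := by
      intro W
      unfold subsetWeight
      split_ifs with h
      · simp [h]
      · simp [h]
    simp only [hw]
    simp only [ite_mul, zero_mul, one_mul, Finset.sum_ite_eq', Finset.mem_univ, if_true, pow_zero,
      Finset.subset_empty]
    split_ifs with h
    · positivity
    · push Not at h
      exact card_le_sum_card_of_nonempty h
  | succ l ih =>
    intro A hA
    obtain ⟨T, hT⟩ := exists_isMinFragment A
    have hq0 : 0 ≤ (1 - p) ^ l := pow_nonneg (by linarith) _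
    have hq1 : (1 - p) ^ l ≤ 1 := pow_le_one₀ (by linarith) (by linarith)
    have e : 1 - (1 - p) ^ (l + 1) = 1 - (1 - p) * (1 - (1 - (1 - p) ^ l)) := by ring
    rw [e, ← sum_subsetWeight_union, Finset.sum_mul]
    calc _ ≤ ∑ W, subsetWeight p W * ((3 / 4) ^ l * ∑ i, ((T W i).card : ℝ)) := by
          refine Finset.sum_le_sum fun W _ => ?_
          rw [mul_assoc]
          refine mul_le_mul_of_nonneg_left ?_ (subsetWeight_nonneg hp0.le hp1 W)
          refine le_trans ?_ (ih (T W) (hA.mono hr.le fun i => hT.subset W i))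
          gcongr with U
          · exact subsetWeight_nonneg (by linarith) (by linarith) U
          · split_ifs with h1 h2 h2
            · exact le_rfl
            · exact zero_le_one
            · exfalso
              obtain ⟨i, hi⟩ := h2
              obtain ⟨j, -, -, hj⟩ := (hT W i).1
              refine h1 ⟨j, ?_⟩
              rw [hj] at hi
              intro v hv
              have := @hi v
              grind
            · exact le_rfl
      _ = (3 / 4) ^ l * ∑ W, subsetWeight p W * ∑ i, ((T W i).card : ℝ) := by
          rw [Finset.mul_sum]
          exact Finset.sum_congr rfl fun W _ => by ring
      _ ≤ (3 / 4) ^ l * (3 / 4 * ∑ i, ((A i).card : ℝ)) := by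
          gcongr
          exact hT.sum_card_le hp0 hp1 hr hA hpr
      _ = _ := by rw [pow_succ]; ring

end Fragments

/-! ### The robust sunflower lemma -/

theorem half_le_log_div {d ε : ℝ} (hd : 1 ≤ d) (hε0 : 0 < ε) (hε : ε ≤ 1 / 2) :
    1 / 2 ≤ Real.log (d / ε) := by
  have h2 : (2 : ℝ) ≤ d / ε := by
    rw [le_div_iff₀ hε0]; linarith
  have := Real.log_le_log (by norm_num) h2
  have := Real.log_two_gt_d9
  linarith

/-- The density of a single exposure round if `l` independent rounds have total density `p`. -/
theorem exists_round_density {p : ℝ} (hp0 : 0 < p) (hp1 : p ≤ 1) {l : ℕ} (hl : 0 < l) :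
    ∃ q : ℝ, p / l ≤ q ∧ q ≤ 1 ∧ 1 - (1 - q) ^ l = p := by
  have hq : (0 : ℝ) ≤ 1 - p := by linarith
  have hl1 : (1 : ℝ) ≤ l := by exact_mod_cast hl
  have hpl : p / l ≤ p := div_le_self hp0.le hl1
  refine ⟨1 - (1 - p) ^ ((l : ℝ)⁻¹), ?_, ?_, ?_⟩
  · have h1 : (1 - p) ≤ (1 - p / l) ^ l := by
      have := one_add_mul_le_pow (a := -(p / l)) (by linarith) l
      have e : 1 + (l : ℝ) * -(p / l) = 1 - p := by
        rw [mul_neg, mul_div_cancel₀ _ (by linarith)]; ring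
      rw [e] at this
      rwa [sub_eq_add_neg 1 (p / l)]
    have h2 : (1 - p) ^ ((l : ℝ)⁻¹) ≤ ((1 - p / l) ^ l) ^ ((l : ℝ)⁻¹) :=
      Real.rpow_le_rpow hq h1 (by positivity)
    rw [Real.pow_rpow_inv_natCast (by linarith) hl.ne'] at h2
    linarith
  · have := Real.rpow_nonneg hq ((l : ℝ)⁻¹)
    linarith
  · rw [sub_sub_cancel, Real.rpow_inv_natCast_pow hq hl.ne']; ring

/-- A random set of density `p` contains a member of a sufficiently spread family of sets of size
at most `d` with probability at least `1 - ε`. The density is spread over about `log (d / ε)`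
rounds of exposure, each of which shrinks the average size by a constant factor. -/
theorem IsSpread.one_sub_le_randomSubsetProb {V ι : Type*} [Fintype V] [DecidableEq V] [Fintype ι]
    [Nonempty ι] {A : ι → Finset V} {p ε r : ℝ} {d : ℕ} (hp0 : 0 < p) (hp1 : p ≤ 1 / 2)
    (hε0 : 0 < ε) (hε1 : ε ≤ 1 / 2) (hd : 1 ≤ d) (hAd : ∀ i, (A i).card ≤ d)
    (hA : IsSpread r A) (hr : 1536 * Real.log ((d : ℝ) / ε) / p ≤ r) :
    1 - ε ≤ randomSubsetProb p (fun R : Finset V => ∃ i, A i ⊆ R) := by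
  classical
  have hd' : (1 : ℝ) ≤ d := by exact_mod_cast hd
  set L := Real.log ((d : ℝ) / ε) with hL
  have hL2 : 1 / 2 ≤ L := half_le_log_div hd' hε0 hε1
  -- There are at most `6 * L` rounds, and `1536 = 6 * 256` leaves density `256 / r` for each.
  obtain ⟨l, hl⟩ : ∃ l, l = ⌈4 * L⌉₊ := ⟨_, rfl⟩
  have hl0 : 0 < l := hl ▸ Nat.ceil_pos.2 (by linarith)
  have hl1 : 4 * L ≤ l := hl ▸ Nat.le_ceil _
  have hl2 : (l : ℝ) ≤ 6 * L := by
    have := Nat.ceil_lt_add_one (show 0 ≤ 4 * L by linarith)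
    rw [hl]; linarith
  have hl0' : (0 : ℝ) < l := by exact_mod_cast hl0
  obtain ⟨p', hp'ge, hp'1, hpow⟩ := exists_round_density hp0 (by linarith) hl0
  have hp'0 : 0 < p' := lt_of_lt_of_le (by positivity) hp'ge
  have hr0 : 0 < r := lt_of_lt_of_le (by positivity) hr
  have hpr : 256 ≤ p' * r := by
    calc (256 : ℝ) ≤ p / l * (1536 * L / p) := by
          rw [div_mul_div_comm, le_div_iff₀ (by positivity)]
          nlinarith
      _ ≤ p' * r := by gcongr
  have hfail := hA.sum_fail_le hp'0 hp'1 hr0 hpr l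
  rw [hpow] at hfail
  set f := ∑ W, subsetWeight p W * (if ∃ i, A i ⊆ W then (0 : ℝ) else 1) with hf
  have hexp : (3 / 4 : ℝ) ^ l ≤ ε / d := by
    have h1 : (3 / 4 : ℝ) ≤ Real.exp (-(1 / 4)) := by
      have := Real.add_one_le_exp (-(1 / 4) : ℝ)
      linarith
    calc (3 / 4 : ℝ) ^ l ≤ Real.exp (-(1 / 4)) ^ l := by gcongr
      _ = Real.exp (-(l / 4)) := by rw [← Real.exp_nat_mul]; congr 1; ring
      _ ≤ Real.exp (-L) := Real.exp_le_exp.2 (by linarith)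
      _ = ε / d := by rw [Real.exp_neg, hL, Real.exp_log (by positivity), inv_div]
  have hsum : ∑ i, ((A i).card : ℝ) ≤ d * Fintype.card ι := by
    calc ∑ i, ((A i).card : ℝ) ≤ ∑ _i : ι, (d : ℝ) :=
          Finset.sum_le_sum fun i _ => by exact_mod_cast hAd i
      _ = _ := by simp [mul_comm]
  have hι : (0 : ℝ) < Fintype.card ι := by exact_mod_cast Fintype.card_pos
  have hfε : f ≤ ε := by
    have : f * Fintype.card ι ≤ ε * Fintype.card ι := by
      calc f * Fintype.card ι ≤ (3 / 4) ^ l * ∑ i, ((A i).card : ℝ) := hfail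
        _ ≤ ε / d * (d * Fintype.card ι) :=
            mul_le_mul hexp hsum (Finset.sum_nonneg fun i _ => Nat.cast_nonneg _)
              (div_nonneg hε0.le (by linarith))
        _ = _ := by rw [← mul_assoc, div_mul_cancel₀ _ (by linarith)]
    exact le_of_mul_le_mul_right this hι
  have hE : randomSubsetProb p (fun R : Finset V => ∃ i, A i ⊆ R) = 1 - f := by
    rw [randomSubsetProb_eq_sum, ← sum_subsetWeight (V := V) p, hf, ← Finset.sum_sub_distrib]
    refine Finset.sum_congr rfl fun W _ => ?_
    split_ifs <;> ring
  rw [hE]; linarith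

theorem randomSubsetProb_mono {V : Type*} [Fintype V] {p : ℝ} (h0 : 0 ≤ p) (h1 : p ≤ 1)
    {E E' : Finset V → Prop} (h : ∀ R, E R → E' R) :
    randomSubsetProb p E ≤ randomSubsetProb p E' := by
  classical
  rw [randomSubsetProb_eq_sum, randomSubsetProb_eq_sum]
  refine Finset.sum_le_sum fun R _ => ?_
  have := subsetWeight_nonneg h0 h1 R
  split_ifs with ha hb hb
  · exact le_rfl
  · exact absurd (h R ha) hb
  · exact this
  · exact le_rfl

theorem subset_sunflowerKernel_iff {α : Type*} [Fintype α] [DecidableEq α]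
    {S : Finset (Finset α)} {K : Finset α} :
    K ⊆ sunflowerKernel S ↔ ∀ N ∈ S, K ⊆ N :=
  Finset.le_inf_iff

theorem sunflowerKernel_subset {α : Type*} [Fintype α] [DecidableEq α]
    {S : Finset (Finset α)} {N : Finset α} (h : N ∈ S) : sunflowerKernel S ⊆ N :=
  subset_sunflowerKernel_iff.1 subset_rfl N h

/-- More than `κ ^ k` sets of size `k` contain a robust sunflower: take a set `K` of largest
size that lies in more than `κ ^ (k - |K|)` members. By maximality the members containing `K`,
with `K` removed, are `κ`-spread. -/
theorem exists_isRobustSunflower_of_uniform {α : Type*} [Fintype α] [DecidableEq α] {p ε κ : ℝ}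
    {d k : ℕ} (hp0 : 0 < p) (hp1 : p ≤ 1 / 2) (hε0 : 0 < ε) (hε1 : ε ≤ 1 / 2) (hd : 1 ≤ d)
    (hκ : 1536 * Real.log ((d : ℝ) / ε) / p ≤ κ) (hκ1 : 1 ≤ κ) (hkd : k ≤ d)
    {𝓕 : Finset (Finset α)} (hk : ∀ N ∈ 𝓕, N.card = k) (hcard : κ ^ k < 𝓕.card) :
    ∃ S, S ⊆ 𝓕 ∧ IsRobustSunflower p ε S := by
  classical
  obtain ⟨K, hK, hmax⟩ := Finset.exists_max_image
    (Finset.univ.filter fun K : Finset α =>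
      κ ^ (k - K.card) < ((𝓕.filter fun N => K ⊆ N).card : ℝ)) Finset.card
    ⟨∅, by simpa using hcard⟩
  simp only [Finset.mem_filter, Finset.mem_univ, true_and] at hK hmax
  set S := 𝓕.filter fun N => K ⊆ N with hS
  have hS1 : 1 < S.card := by
    have : (1 : ℝ) < S.card := lt_of_le_of_lt (one_le_pow₀ hκ1) hK
    exact_mod_cast this
  have hmemS : ∀ N ∈ S, N ∈ 𝓕 ∧ K ⊆ N := fun N hN => by simpa [hS] using hN
  have hSk : ∀ N ∈ S, N.card = k := fun N hN => hk N (hmemS N hN).1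
  refine ⟨S, Finset.filter_subset _ _, ?_, ?_⟩
  · intro hker
    have : S.card ≤ 1 := by
      rw [Finset.card_le_one]
      have hu : ∀ N ∈ S, sunflowerKernel S = N := fun N hN =>
        Finset.eq_of_subset_of_card_le (sunflowerKernel_subset hN)
          (by rw [hSk N hN, hSk _ hker])
      intro a ha b hb
      rw [← hu a ha, ← hu b hb]
    omega
  · have hne : S.Nonempty := Finset.card_pos.1 (by omega)
    have : Nonempty {N // N ∈ S} := hne.to_subtype
    set A : {N // N ∈ S} → Finset α := fun N => N.1 \ K with hA
    have hspread : IsSpread κ A := by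
      intro Z
      have hκ0 : 0 ≤ κ := by linarith
      rw [Fintype.card_coe]
      rcases Z.eq_empty_or_nonempty with rfl | hZ
      · simp
      have hle : ((Finset.univ.filter fun i => Z ⊆ A i).card) ≤
          (𝓕.filter fun N => K ∪ Z ⊆ N).card := by
        refine Finset.card_le_card_of_injOn Subtype.val ?_ Subtype.val_injective.injOn
        intro N hN
        simp only [hA, Finset.coe_filter, Finset.mem_univ, true_and, Set.mem_ofPred_eq] at hN
        have h1 := hmemS N.1 N.2
        simp only [Finset.coe_filter, Set.mem_ofPred_eq]
        exact ⟨h1.1, Finset.union_subset h1.2 (hN.trans Finset.sdiff_subset)⟩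
      by_cases hdj : Disjoint K Z
      · have hc : (K ∪ Z).card = K.card + Z.card := Finset.card_union_of_disjoint hdj
        have hZ1 := hZ.card_pos
        by_cases hkZ : K.card + Z.card ≤ k
        · have h1 : ((𝓕.filter fun N => K ∪ Z ⊆ N).card : ℝ) ≤ κ ^ (k - (K ∪ Z).card) := by
            by_contra hcon
            have := hmax (K ∪ Z) (not_le.1 hcon)
            omega
          calc _ ≤ κ ^ (k - (K ∪ Z).card) * κ ^ Z.card := by
                gcongr
                exact le_trans (by exact_mod_cast hle) h1
            _ = κ ^ (k - K.card) := by rw [← pow_add, hc]; congr 1; omega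
            _ ≤ _ := hK.le
        · have h0 : (𝓕.filter fun N => K ∪ Z ⊆ N) = ∅ := by
            rw [Finset.filter_eq_empty_iff]
            intro N hN hsub
            have := Finset.card_le_card hsub
            rw [hk N hN] at this
            omega
          rw [h0, Finset.card_empty, Nat.le_zero] at hle
          rw [hle]; simp
      · have h0 : (Finset.univ.filter fun i => Z ⊆ A i) = ∅ := by
          rw [Finset.filter_eq_empty_iff]
          intro N _ hsub
          exact hdj (Finset.disjoint_of_subset_right hsub Finset.disjoint_sdiff)
        rw [h0]; simp
    have hAd : ∀ i, (A i).card ≤ d := fun i =>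
      (Finset.card_le_card Finset.sdiff_subset).trans ((hSk i.1 i.2).le.trans hkd)
    refine (hspread.one_sub_le_randomSubsetProb hp0 hp1 hε0 hε1 hd hAd hκ).trans
      (randomSubsetProb_mono hp0.le (by linarith) ?_)
    rintro R ⟨N, hN⟩
    refine ⟨N.1, N.2, ?_⟩
    have hKker : K ⊆ sunflowerKernel S :=
      subset_sunflowerKernel_iff.2 fun N hN => (hmemS N hN).2
    intro v hv
    by_cases hvK : v ∈ K
    · exact Finset.mem_union_right _ (hKker hvK)
    · exact Finset.mem_union_left _ (hN (by simp [hA, hv, hvK]))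

theorem exists_isRobustSunflowerConstant : ∃ B : ℝ, IsRobustSunflowerConstant B := by
  classical
  -- Twice the constant of the spread lemma, so that the count exceeds `κ ^ k` strictly.
  refine ⟨3072, by norm_num, ?_⟩
  intro α _ _ p ε d 𝓕 hp0 hp1 hε0 hε1 hd hF hcard
  have hd' : (1 : ℝ) ≤ d := by exact_mod_cast hd
  have hL := half_le_log_div hd' hε0 hε1
  set κ := 1536 * Real.log ((d : ℝ) / ε) / p with hκ
  have hκ1 : 1 ≤ κ := by
    rw [hκ, le_div_iff₀ hp0]; linarith
  have h2κ : 3072 * Real.log ((d : ℝ) / ε) / p = 2 * κ := by rw [hκ]; ring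
  rw [h2κ] at hcard
  -- Some size class carries its share of the family.
  obtain ⟨k, hk, hkc⟩ : ∃ k ∈ Finset.Icc 1 d,
      (2 * κ) ^ d ≤ ((𝓕.filter fun N => N.card = k).card : ℝ) := by
    refine Finset.exists_le_of_sum_le ⟨1, by simpa using hd⟩ ?_
    rw [Finset.sum_const, Nat.card_Icc, nsmul_eq_mul, Nat.add_sub_cancel, ← Nat.cast_sum,
      ← Finset.card_eq_sum_card_fiberwise]
    · exact hcard
    · intro N hN
      have := hF N hN
      exact Finset.mem_coe.2 (Finset.mem_Icc.2 ⟨this.1.card_pos, this.2⟩)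
  rw [Finset.mem_Icc] at hk
  have hlt : κ ^ k < ((𝓕.filter fun N => N.card = k).card : ℝ) := by
    refine lt_of_lt_of_le ?_ hkc
    calc κ ^ k ≤ κ ^ d := pow_le_pow_right₀ hκ1 hk.2
      _ < (2 * κ) ^ d := pow_lt_pow_left₀ (by linarith) (by linarith) (by omega)
  obtain ⟨S, hS, hrob⟩ := exists_isRobustSunflower_of_uniform hp0 hp1 hε0 hε1 hd le_rfl hκ1 hk.2
    (fun N hN => (Finset.mem_filter.1 hN).2) hlt
  exact ⟨S, hS.trans (Finset.filter_subset _ _), hrob⟩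

/-! ### Sunflowers under uniform random assignments -/

theorem Finset.prod_ite_const_mem {V : Type*} [Fintype V] [DecidableEq V] (R : Finset V) (a b : ℕ) :
    ∏ j, (if j ∈ R then a else b) = a ^ R.card * b ^ (Fintype.card V - R.card) := by
  rw [Finset.prod_ite, Finset.prod_const, Finset.prod_const, ← Finset.card_compl]
  congr 2
  · congr 1; ext; simp
  · congr 1; ext; simp

/-- The set of coordinates at which a uniformly random `W`-valued function takes the value `a` is a
random set of density `1 / |W|`. -/
theorem randomSubsetProb_mul_card_pow {V W : Type*} [Fintype V] [DecidableEq V] [Fintype W]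
    [DecidableEq W] (a : W) (E : Finset V → Prop) [DecidablePred E] :
    randomSubsetProb (1 / (Fintype.card W : ℝ)) E * (Fintype.card W : ℝ) ^ Fintype.card V =
      ((Finset.univ.filter fun f : V → W => E (Finset.univ.filter fun j => f j = a)).card : ℝ) := by
  have hw0 : 0 < Fintype.card W := Fintype.card_pos_iff.2 ⟨a⟩
  have hw : (0 : ℝ) < Fintype.card W := by exact_mod_cast hw0
  have hfib : ∀ R : Finset V,
      ((Finset.univ.filter fun f : V → W => (Finset.univ.filter fun j => f j = a) = R).card : ℝ) =
        subsetWeight (1 / (Fintype.card W : ℝ)) R * (Fintype.card W : ℝ) ^ Fintype.card V := by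
    intro R
    have h1 : (Finset.univ.filter fun f : V → W => (Finset.univ.filter fun j => f j = a) = R) =
        Fintype.piFinset fun j => if j ∈ R then {a} else Finset.univ.erase a := by
      ext f
      simp only [Finset.mem_filter, Finset.mem_univ, true_and, Fintype.mem_piFinset,
        Finset.ext_iff]
      refine forall_congr' fun j => ?_
      by_cases hj : j ∈ R <;> simp [hj]
    have h2 : ∀ j, (if j ∈ R then ({a} : Finset W) else Finset.univ.erase a).card =
        if j ∈ R then 1 else Fintype.card W - 1 := by
      intro j; split_ifs <;> simp
    rw [h1, Fintype.card_piFinset, Finset.prod_congr rfl fun j _ => h2 j,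
      Finset.prod_ite_const_mem]
    unfold subsetWeight
    have hR := Finset.card_le_univ R
    conv_rhs => rw [← Nat.add_sub_cancel' hR, pow_add, Nat.add_sub_cancel_left]
    rw [mul_mul_mul_comm, ← mul_pow, ← mul_pow, sub_mul, one_div, inv_mul_cancel₀ hw.ne']
    push_cast [Nat.cast_sub (show 1 ≤ Fintype.card W from hw0)]
    ring
  rw [randomSubsetProb_eq_sum, Finset.sum_mul]
  rw [Finset.card_eq_sum_card_fiberwise (t := Finset.univ)
    (f := fun f : V → W => Finset.univ.filter fun j => f j = a) (fun _ _ => by simp)]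
  push_cast
  refine Finset.sum_congr rfl fun R _ => ?_
  rw [ite_mul, zero_mul, ← hfib]
  split_ifs with h
  · congr 2
    ext f
    simp only [Finset.mem_filter, Finset.mem_univ, true_and]
    exact ⟨fun hf => ⟨hf ▸ h, hf⟩, fun hf => hf.2⟩
  · symm
    rw [Nat.cast_eq_zero, Finset.card_eq_zero, Finset.filter_eq_empty_iff]
    intro f hf hfR
    simp only [Finset.mem_filter, Finset.mem_univ, true_and] at hf
    exact h (hfR ▸ hf)

/-- Let `K` be the kernel of a `(1 / 2q, ε)`-robust sunflower. Conditioned on a uniform assignment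
being true on `K`, it is true on at least `q` members of the sunflower, up to probability `q * ε`.
Colour the coordinates with `q` colours: the true coordinates of each colour form a random set of
density `1 / 2q`, and members completed by different colours are different. -/
theorem IsRobustSunflower.card_few_le {V : Type*} [Fintype V] [DecidableEq V] {q : ℕ} (hq : 1 ≤ q)
    {ε : ℝ} {S : Finset (Finset V)} (hS : IsRobustSunflower (1 / (2 * (q : ℝ))) ε S) :
    ((Finset.univ.filter fun z : V → Bool => (∀ j ∈ sunflowerKernel S, z j = true) ∧
      (S.filter fun N => ∀ j ∈ N, z j = true).card < q).card : ℝ) * 2 ^ (sunflowerKernel S).card ≤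
      q * ε * 2 ^ Fintype.card V := by
  classical
  set K := sunflowerKernel S with hK
  set bad : (V → Bool) → Prop := fun z => (S.filter fun N => ∀ j ∈ N, z j = true).card < q
    with hbad
  set ov : (V → Fin q × Bool) → V → Bool := fun w j => if j ∈ K then true else (w j).2 with hov
  set Z := Finset.univ.filter fun z : V → Bool => (∀ j ∈ K, z j = true) ∧ bad z with hZ
  have hq0 : (0 : ℝ) < q := by exact_mod_cast hq
  have hcardW : Fintype.card (Fin q × Bool) = 2 * q := by simp [mul_comm]
  have hfib : ∀ z ∈ Z, (Finset.univ.filter fun w : V → Fin q × Bool => ov w = z).card =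
      2 ^ K.card * q ^ Fintype.card V := by
    intro z hz
    simp only [hZ, Finset.mem_filter, Finset.mem_univ, true_and] at hz
    have h1 : (Finset.univ.filter fun w : V → Fin q × Bool => ov w = z) =
        Fintype.piFinset fun j => if j ∈ K then Finset.univ else Finset.univ ×ˢ {z j} := by
      ext w
      simp only [Finset.mem_filter, Finset.mem_univ, true_and, Fintype.mem_piFinset,
        funext_iff, hov]
      refine forall_congr' fun j => ?_
      by_cases hj : j ∈ K
      · simp [hj, hz.1 j hj]
      · simp only [hj, if_false, Finset.mem_product, Finset.mem_univ, true_and,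
          Finset.mem_singleton]
    have h2 : ∀ j, (if j ∈ K then (Finset.univ : Finset (Fin q × Bool))
        else Finset.univ ×ˢ {z j}).card = if j ∈ K then 2 * q else q := by
      intro j
      split_ifs
      · rw [Finset.card_univ, hcardW]
      · simp
    rw [h1, Fintype.card_piFinset, Finset.prod_congr rfl fun j _ => h2 j,
      Finset.prod_ite_const_mem, mul_pow, mul_assoc, ← pow_add,
      Nat.add_sub_cancel' (Finset.card_le_univ K)]
  have hZle : Z.card * (2 ^ K.card * q ^ Fintype.card V) ≤
      (Finset.univ.filter fun w : V → Fin q × Bool => bad (ov w)).card := by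
    have h1 : ∑ z ∈ Z, (Finset.univ.filter fun w : V → Fin q × Bool => ov w = z).card =
        Z.card * (2 ^ K.card * q ^ Fintype.card V) := by
      rw [Finset.sum_congr rfl hfib, Finset.sum_const, smul_eq_mul]
    rw [← h1, ← Finset.card_biUnion]
    · refine Finset.card_le_card fun w hw => ?_
      simp only [Finset.mem_biUnion, Finset.mem_filter, Finset.mem_univ, true_and, hZ] at hw ⊢
      obtain ⟨z, hz, rfl⟩ := hw
      exact hz.2
    · intro z _ z' _ hzz'
      rw [Function.onFun, Finset.disjoint_left]
      intro w hw hw'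
      simp only [Finset.mem_filter, Finset.mem_univ, true_and] at hw hw'
      exact hzz' (hw.symm.trans hw')
  set miss : Fin q → (V → Fin q × Bool) → Prop := fun c w =>
    ¬ ∃ N ∈ S, N ⊆ (Finset.univ.filter fun j => w j = (c, true)) ∪ K with hmiss
  have hbadmiss : ∀ w, bad (ov w) → ∃ c, miss c w := by
    intro w hw
    by_contra hcon
    have hcon' : ∀ c, ∃ N ∈ S, N ⊆ (Finset.univ.filter fun j => w j = (c, true)) ∪ K :=
      fun c => not_not.1 fun h => hcon ⟨c, h⟩
    choose N hNS hN using hcon'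
    have hinj : Function.Injective N := by
      intro c c' hcc
      by_contra hne
      -- A member completed by two colours lies in the kernel, hence equals it.
      have hsub : N c ⊆ K := by
        intro v hv
        have h1 := hN c hv
        have h2 := hN c' (hcc ▸ hv)
        simp only [Finset.mem_union, Finset.mem_filter, Finset.mem_univ, true_and] at h1 h2
        rcases h1 with h1 | h1
        · rcases h2 with h2 | h2
          · rw [h1] at h2
            exact absurd (congrArg Prod.fst h2) hne
          · exact h2
        · exact h1
      have heq : N c = K := Finset.Subset.antisymm hsub (sunflowerKernel_subset (hNS c))
      have hmem := hNS c
      rw [heq] at hmem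
      exact hS.1 hmem
    have hle : q ≤ (S.filter fun N => ∀ j ∈ N, ov w j = true).card := by
      calc q = (Finset.univ.image N).card := by
            rw [Finset.card_image_of_injective _ hinj, Finset.card_univ, Fintype.card_fin]
        _ ≤ _ := by
            refine Finset.card_le_card fun M hM => ?_
            obtain ⟨c, -, rfl⟩ := Finset.mem_image.1 hM
            refine Finset.mem_filter.2 ⟨hNS c, fun j hj => ?_⟩
            have := hN c hj
            simp only [Finset.mem_union, Finset.mem_filter, Finset.mem_univ, true_and] at this
            simp only [hov]
            split_ifs with hjK
            · rfl
            · rcases this with h | h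
              · rw [h]
              · exact absurd h hjK
    exact absurd hw (not_lt.2 hle)
  have hmisscard : ∀ c, ((Finset.univ.filter fun w => miss c w).card : ℝ) ≤
      ε * (2 * q) ^ Fintype.card V := by
    intro c
    have h1 := randomSubsetProb_mul_card_pow (V := V) ((c, true) : Fin q × Bool)
      (fun R => ∃ N ∈ S, N ⊆ R ∪ K)
    have h2 := Finset.card_filter_add_card_filter_not
      (s := (Finset.univ : Finset (V → Fin q × Bool)))
      (fun w => ∃ N ∈ S, N ⊆ (Finset.univ.filter fun j => w j = (c, true)) ∪ K)
    rw [Finset.card_univ, Fintype.card_fun, hcardW] at h2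
    rw [hcardW] at h1
    have h3 : ((Finset.univ.filter fun w : V → Fin q × Bool =>
        ∃ N ∈ S, N ⊆ (Finset.univ.filter fun j => w j = (c, true)) ∪ K).card : ℝ) +
        ((Finset.univ.filter fun w => miss c w).card : ℝ) = (2 * q) ^ Fintype.card V := by
      exact_mod_cast h2
    push_cast at h1
    have h4 := hS.2
    have h5 : (0 : ℝ) < (2 * q) ^ Fintype.card V := by positivity
    have h6 := mul_le_mul_of_nonneg_right h4 h5.le
    rw [h1] at h6
    linarith
  have hbadle : ((Finset.univ.filter fun w : V → Fin q × Bool => bad (ov w)).card : ℝ) ≤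
      q * (ε * (2 * q) ^ Fintype.card V) := by
    calc ((Finset.univ.filter fun w : V → Fin q × Bool => bad (ov w)).card : ℝ)
        ≤ ((Finset.univ.biUnion fun c => Finset.univ.filter fun w => miss c w).card : ℝ) := by
          refine Nat.cast_le.2 (Finset.card_le_card fun w hw => ?_)
          simp only [Finset.mem_biUnion, Finset.mem_filter, Finset.mem_univ, true_and] at hw ⊢
          exact hbadmiss w hw
      _ ≤ ∑ c, ((Finset.univ.filter fun w => miss c w).card : ℝ) := by
          exact_mod_cast Finset.card_biUnion_le
      _ ≤ ∑ _c : Fin q, ε * (2 * q) ^ Fintype.card V := Finset.sum_le_sum fun c _ => hmisscard c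
      _ = _ := by simp
  have hfin : (Z.card : ℝ) * 2 ^ K.card * q ^ Fintype.card V ≤
      (q * ε * 2 ^ Fintype.card V) * q ^ Fintype.card V := by
    calc (Z.card : ℝ) * 2 ^ K.card * q ^ Fintype.card V
        = ((Z.card * (2 ^ K.card * q ^ Fintype.card V) : ℕ) : ℝ) := by push_cast; ring
      _ ≤ q * (ε * (2 * q) ^ Fintype.card V) := le_trans (by exact_mod_cast hZle) hbadle
      _ = _ := by rw [mul_pow]; ring
  exact le_of_mul_le_mul_right hfin (by positivity)

/-! ### Sunflowers of partial assignments -/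

/-- A finite set of literals `(j, b)`, read as the partial assignment giving the value `b` to the
variable `j`, agrees with the assignment `y`. -/
def LitSat {V : Type*} (N : Finset (V × Bool)) (y : V → Bool) : Prop :=
  ∀ l ∈ N, y l.1 = l.2

instance {V : Type*} (N : Finset (V × Bool)) (y : V → Bool) : Decidable (LitSat N y) :=
  inferInstanceAs (Decidable (∀ l ∈ N, y l.1 = l.2))

theorem LitSat.mono {V : Type*} {N M : Finset (V × Bool)} {y : V → Bool} (h : LitSat N y)
    (hM : M ⊆ N) : LitSat M y :=
  fun l hl => h l (hM hl)

section Literals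

variable {V : Type*} [DecidableEq V]

theorem LitSat.eq_image {N : Finset (V × Bool)} {x : V → Bool} (h : LitSat N x) :
    (N.image Prod.fst).image (fun j => (j, x j)) = N := by
  rw [Finset.image_image]
  conv_rhs => rw [← Finset.image_id (s := N)]
  refine Finset.image_congr fun l hl => ?_
  exact Prod.ext rfl (h l hl)

theorem card_image_graph (x : V → Bool) (D : Finset V) :
    (D.image fun j => (j, x j)).card = D.card :=
  Finset.card_image_of_injective _ fun _ _ h => congrArg Prod.fst h

theorem LitSat.card_image_fst {N : Finset (V × Bool)} {x : V → Bool} (h : LitSat N x) :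
    (N.image Prod.fst).card = N.card := by
  rw [← card_image_graph x, h.eq_image]

theorem litSat_image {x y : V → Bool} (D : Finset V) :
    LitSat (D.image fun j => (j, x j)) y ↔ ∀ j ∈ D, y j = x j := by
  simp [LitSat]

theorem card_litSat [Fintype V] {N : Finset (V × Bool)} (hN : ∃ x, LitSat N x) :
    (Finset.univ.filter fun y => LitSat N y).card * 2 ^ N.card = 2 ^ Fintype.card V := by
  obtain ⟨x, hx⟩ := hN
  set D := N.image Prod.fst with hD
  have h1 : (Finset.univ.filter fun y => LitSat N y) =
      Fintype.piFinset fun j => if j ∈ D then {x j} else Finset.univ := by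
    ext y
    rw [← hx.eq_image]
    simp only [Finset.mem_filter, Finset.mem_univ, true_and, Fintype.mem_piFinset, litSat_image]
    refine forall_congr' fun j => ?_
    by_cases hj : j ∈ D
    · simp [hj, ← hD]
    · simp [hj, ← hD]
  have h2 : ∀ j, (if j ∈ D then {x j} else (Finset.univ : Finset Bool)).card =
      if j ∈ D then 1 else 2 := by
    intro j; split_ifs <;> simp
  rw [h1, Fintype.card_piFinset, Finset.prod_congr rfl fun j _ => h2 j,
    Finset.prod_ite_const_mem, one_pow, one_mul, hD, hx.card_image_fst, ← pow_add]
  congr 1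
  have := Finset.card_le_univ D
  rw [hD, hx.card_image_fst] at this
  omega

/-- Among partial assignments extending `K` by at most `k` variables, a fraction `2 ^ (-k)` agrees
with a common total assignment. -/
theorem exists_common_assignment [Fintype V] {K : Finset (V × Bool)}
    {𝓝 : Finset (Finset (V × Bool))} {k : ℕ} (hne : 𝓝.Nonempty)
    (h : ∀ N ∈ 𝓝, K ⊆ N ∧ (∃ x, LitSat N x) ∧ N.card ≤ K.card + k) :
    ∃ x, LitSat K x ∧ 𝓝.card ≤ (𝓝.filter fun N => LitSat N x).card * 2 ^ k := by
  have hK : ∃ x, LitSat K x := by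
    obtain ⟨N, hN⟩ := hne
    obtain ⟨h1, ⟨x, hx⟩, -⟩ := h N hN
    exact ⟨x, hx.mono h1⟩
  have hcK := card_litSat hK
  set Q := Finset.univ.filter fun x => LitSat K x with hQ
  have hQne : Q.Nonempty := by
    obtain ⟨x, hx⟩ := hK
    exact ⟨x, by simp [hQ, hx]⟩
  obtain ⟨x, hx, hle⟩ : ∃ x ∈ Q, 𝓝.card ≤ (𝓝.filter fun N => LitSat N x).card * 2 ^ k := by
    refine Finset.exists_le_of_sum_le hQne ?_
    have h1 : ∑ x ∈ Q, (𝓝.filter fun N => LitSat N x).card * 2 ^ k =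
        ∑ N ∈ 𝓝, (Finset.univ.filter fun x => LitSat N x).card * 2 ^ k := by
      rw [← Finset.sum_mul, ← Finset.sum_mul]
      congr 1
      simp_rw [Finset.card_filter]
      rw [Finset.sum_comm]
      refine Finset.sum_congr rfl fun N hN => ?_
      rw [hQ, Finset.sum_filter]
      refine Finset.sum_congr rfl fun x _ => ?_
      have := h N hN
      by_cases hs : LitSat N x
      · simp [hs, hs.mono this.1]
      · simp [hs]
    rw [h1, Finset.sum_const, smul_eq_mul, mul_comm, ← smul_eq_mul, ← Finset.sum_const]
    refine Finset.sum_le_sum fun N hN => ?_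
    obtain ⟨-, hs, hc⟩ := h N hN
    have h2 := card_litSat hs
    have h3 : (Finset.univ.filter fun x => LitSat N x).card * 2 ^ N.card ≤
        (Finset.univ.filter fun x => LitSat N x).card * 2 ^ (K.card + k) :=
      Nat.mul_le_mul_left _ (Nat.pow_le_pow_right (by norm_num) hc)
    rw [h2, ← hcK, pow_add] at h3
    have h4 : 0 < 2 ^ K.card := by positivity
    nlinarith
  simp only [hQ, Finset.mem_filter, Finset.mem_univ, true_and] at hx
  exact ⟨x, hx, hle⟩

end Literals

theorem IsRobustSunflower.nonempty {V : Type*} [Fintype V] [DecidableEq V] {p ε : ℝ}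
    {S : Finset (Finset V)} (hS : IsRobustSunflower p ε S) (hε : ε < 1) : S.Nonempty := by
  rw [Finset.nonempty_iff_ne_empty]
  rintro rfl
  have := hS.2
  simp only [Finset.notMem_empty, false_and, exists_false] at this
  rw [randomSubsetProb_eq_sum] at this
  simp only [if_false, Finset.sum_const_zero] at this
  linarith

/-- The robust sunflower lemma for sets with a common part `K`: only the size of the sets outside
`K` matters. -/
theorem IsRobustSunflowerConstant.exists_of_subset {B : ℝ} (hB : IsRobustSunflowerConstant B)
    {V : Type} [Fintype V] [DecidableEq V] {p ε : ℝ} {d : ℕ} {𝓕 : Finset (Finset V)} {K : Finset V}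
    (hp0 : 0 < p) (hp1 : p ≤ 1 / 2) (hε0 : 0 < ε) (hε1 : ε ≤ 1 / 2) (hd : 1 ≤ d)
    (h𝓕 : ∀ N ∈ 𝓕, K ⊆ N ∧ K ≠ N ∧ N.card ≤ K.card + d)
    (hcard : (d : ℝ) * (B * Real.log ((d : ℝ) / ε) / p) ^ d ≤ (𝓕.card : ℝ)) :
    ∃ S, S ⊆ 𝓕 ∧ IsRobustSunflower p ε S := by
  classical
  have hinj : Set.InjOn (fun N => N \ K) (𝓕 : Set (Finset V)) := by
    intro N hN M hM hNM
    dsimp only at hNM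
    rw [← Finset.sdiff_union_of_subset (h𝓕 N hN).1, hNM,
      Finset.sdiff_union_of_subset (h𝓕 M hM).1]
  obtain ⟨S₀, hS₀, hker, hprob⟩ := hB.2 V p ε d (𝓕.image fun N => N \ K) hp0 hp1 hε0 hε1 hd
    (by
      intro M hM
      obtain ⟨N, hN, rfl⟩ := Finset.mem_image.1 hM
      obtain ⟨h1, h2, h3⟩ := h𝓕 N hN
      refine ⟨Finset.sdiff_nonempty.2 fun h => h2 (h1.antisymm h), ?_⟩
      rw [Finset.card_sdiff_of_subset h1]; omega)
    (by rw [Finset.card_image_of_injOn hinj]; exact hcard)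
  set S := 𝓕.filter fun N => N \ K ∈ S₀ with hS
  have hS₀S : ∀ M ∈ S₀, Disjoint M K ∧ M ∪ K ∈ S := by
    intro M hM
    obtain ⟨N, hN, rfl⟩ := Finset.mem_image.1 (hS₀ hM)
    refine ⟨Finset.sdiff_disjoint, ?_⟩
    rw [Finset.sdiff_union_of_subset (h𝓕 N hN).1, hS, Finset.mem_filter]
    exact ⟨hN, hM⟩
  have hKS : K ⊆ sunflowerKernel S :=
    subset_sunflowerKernel_iff.2 fun N hN => (h𝓕 N (Finset.mem_filter.1 hN).1).1
  have hle : sunflowerKernel S₀ ⊆ sunflowerKernel S :=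
    subset_sunflowerKernel_iff.2 fun N hN =>
      (sunflowerKernel_subset (Finset.mem_filter.1 hN).2).trans Finset.sdiff_subset
  have hge : sunflowerKernel S \ K ⊆ sunflowerKernel S₀ := by
    refine subset_sunflowerKernel_iff.2 fun M hM v hv => ?_
    have h1 := hS₀S M hM
    rw [Finset.mem_sdiff] at hv
    rcases Finset.mem_union.1 (sunflowerKernel_subset h1.2 hv.1) with h | h
    · exact h
    · exact absurd h hv.2
  refine ⟨S, Finset.filter_subset _ _, ?_, ?_⟩
  · intro hmem
    have h1 := (Finset.mem_filter.1 hmem).2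
    exact hker (hge.antisymm (sunflowerKernel_subset h1) ▸ h1)
  · refine hprob.trans (randomSubsetProb_mono hp0.le (by linarith) ?_)
    rintro R ⟨M, hM, hMR⟩
    exact ⟨M ∪ K, (hS₀S M hM).2, Finset.union_subset
      (hMR.trans (Finset.union_subset_union_right hle))
      (hKS.trans Finset.subset_union_right)⟩

/-- Many partial assignments extending `K₀` contain a subfamily with common part `K` such that a
uniform assignment that agrees with `K` agrees with at least `q` members, up to probability
`q * ε`. -/
theorem IsRobustSunflowerConstant.exists_litSat_sunflower {B : ℝ}
    (hB : IsRobustSunflowerConstant B) {V : Type} [Fintype V] [DecidableEq V] {ε : ℝ} {d q : ℕ}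
    {𝓝 : Finset (Finset (V × Bool))} {K₀ : Finset (V × Bool)}
    (hq : 1 ≤ q) (hε0 : 0 < ε) (hε1 : ε ≤ 1 / 2) (hd : 1 ≤ d) (hne : 𝓝.Nonempty)
    (h𝓝 : ∀ N ∈ 𝓝, K₀ ⊆ N ∧ K₀ ≠ N ∧ N.card ≤ K₀.card + d ∧ ∃ x, LitSat N x)
    (hcard : (d : ℝ) * (4 * q * B * Real.log ((d : ℝ) / ε)) ^ d ≤ (𝓝.card : ℝ)) :
    ∃ S K, S ⊆ 𝓝 ∧ S.Nonempty ∧ (∃ x, LitSat K x) ∧ K₀ ⊆ K ∧ (∀ N ∈ S, K ⊆ N) ∧ K ∉ S ∧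
      ((Finset.univ.filter fun y : V → Bool => LitSat K y ∧
        (S.filter fun N => LitSat N y).card < q).card : ℝ) * 2 ^ K.card ≤
        q * ε * 2 ^ Fintype.card V := by
  classical
  obtain ⟨x, hxK, hx⟩ := exists_common_assignment hne
    fun N hN => ⟨(h𝓝 N hN).1, (h𝓝 N hN).2.2.2, (h𝓝 N hN).2.2.1⟩
  set 𝓜 := 𝓝.filter fun N => LitSat N x with h𝓜
  set D : Finset (V × Bool) → Finset V := fun N => N.image Prod.fst with hD
  set L : Finset V → Finset (V × Bool) := fun E => E.image fun j => (j, x j) with hL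
  have hLD : ∀ N, LitSat N x → L (D N) = N := fun N hN => hN.eq_image
  have hDL : ∀ E, D (L E) = E := by
    intro E
    simp [hD, hL, Finset.image_image, Function.comp_def]
  have hLmono : ∀ E F, E ⊆ F → L E ⊆ L F := fun E F h => Finset.image_subset_image h
  have hDmono : ∀ N M, N ⊆ M → D N ⊆ D M := fun N M h => Finset.image_subset_image h
  have hsat : ∀ N ∈ 𝓜, LitSat N x := fun N hN => (Finset.mem_filter.1 hN).2
  have hq0 : (0 : ℝ) < q := by exact_mod_cast hq
  have hq1 : (1 : ℝ) ≤ q := by exact_mod_cast hq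
  have hinj : Set.InjOn D (𝓜 : Set _) := by
    intro N hN M hM hNM
    rw [← hLD N (hsat N hN), hNM, hLD M (hsat M hM)]
  obtain ⟨S₀, hS₀, hrob⟩ := hB.exists_of_subset (p := 1 / (2 * (q : ℝ))) (ε := ε) (d := d)
    (𝓕 := 𝓜.image D) (K := D K₀) (by positivity)
    (by rw [one_div_le_one_div (by positivity) (by norm_num)]; linarith) hε0 hε1 hd
    (by
      intro E hE
      obtain ⟨N, hN, rfl⟩ := Finset.mem_image.1 hE
      obtain ⟨h1, h2, h3, -⟩ := h𝓝 N (Finset.mem_filter.1 hN).1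
      refine ⟨hDmono _ _ h1, fun h => h2 ?_, ?_⟩
      · rw [← hLD K₀ hxK, h, hLD N (hsat N hN)]
      · rw [hD]
        dsimp only
        rw [hxK.card_image_fst, (hsat N hN).card_image_fst]
        exact h3)
    (by
      rw [Finset.card_image_of_injOn hinj]
      have h1 : (𝓝.card : ℝ) ≤ 𝓜.card * 2 ^ d := by exact_mod_cast hx
      have h2 : B * Real.log ((d : ℝ) / ε) / (1 / (2 * (q : ℝ))) =
          (4 * q * B * Real.log ((d : ℝ) / ε)) / 2 := by
        field_simp; ring
      rw [h2, div_pow, ← mul_div_assoc, div_le_iff₀ (by positivity)]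
      exact hcard.trans h1)
  have hS₀sub : ∀ E ∈ S₀, L E ∈ 𝓜 := by
    intro E hE
    obtain ⟨N, hN, rfl⟩ := Finset.mem_image.1 (hS₀ hE)
    rw [hLD N (hsat N hN)]
    exact hN
  have hLinj : Function.Injective L := fun E F h => by rw [← hDL E, h, hDL]
  set K := sunflowerKernel S₀ with hK
  refine ⟨S₀.image L, L K, ?_, (hrob.nonempty (by linarith)).image L, ⟨x, ?_⟩, ?_, ?_, ?_, ?_⟩
  · intro N hN
    obtain ⟨E, hE, rfl⟩ := Finset.mem_image.1 hN
    exact (Finset.mem_filter.1 (hS₀sub E hE)).1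
  · rw [hL, litSat_image]; exact fun _ _ => rfl
  · rw [← hLD K₀ hxK]
    refine hLmono _ _ (subset_sunflowerKernel_iff.2 fun E hE => ?_)
    rw [← hDL E]
    exact hDmono _ _ (h𝓝 _ (Finset.mem_filter.1 (hS₀sub E hE)).1).1
  · intro N hN
    obtain ⟨E, hE, rfl⟩ := Finset.mem_image.1 hN
    exact hLmono _ _ (sunflowerKernel_subset hE)
  · intro hmem
    obtain ⟨E, hE, hEK⟩ := Finset.mem_image.1 hmem
    rw [hLinj hEK] at hE
    exact hrob.1 hE
  · have hcK : (L K).card = K.card := card_image_graph x K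
    rw [hcK]
    refine le_trans ?_ (hrob.card_few_le hq)
    refine mul_le_mul_of_nonneg_right (Nat.cast_le.2 ?_) (by positivity)
    -- The positions where `y` agrees with `x` are themselves uniformly distributed.
    refine Finset.card_le_card_of_injOn (fun y j => y j == x j) ?_ ?_
    · intro y hy
      simp only [Finset.coe_filter, Finset.mem_univ, true_and, Set.mem_ofPred_eq] at hy ⊢
      have hLs : ∀ E, LitSat (L E) y ↔ ∀ j ∈ E, (y j == x j) = true := by
        intro E
        rw [hL, litSat_image]
        simp
      refine ⟨(hLs K).1 hy.1, ?_⟩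
      rw [Finset.filter_image, Finset.card_image_of_injective _ hLinj] at hy
      simpa only [hLs] using hy.2
    · intro y _ z _ hyz
      funext j
      have := congrFun hyz j
      dsimp only at this
      revert this
      cases y j <;> cases z j <;> cases x j <;> simp

/-! ### Minimal avoided partial assignments -/

open Finset in
/-- The set `G` of assignments avoids the (satisfiable) partial assignment `K`: conditioned on
agreeing with `K`, a uniform assignment is in `G` with probability at most `η |K|`. -/
def IsAvoided {V : Type*} [Fintype V] [DecidableEq V] (G : Finset (V → Bool)) (η : ℕ → ℝ)
    (K : Finset (V × Bool)) : Prop :=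
  (∃ x, LitSat K x) ∧ (#{y ∈ G | LitSat K y} : ℝ) * 2 ^ #K ≤ η #K * 2 ^ Fintype.card V

section Avoided

variable {V : Type} [Fintype V] [DecidableEq V]

/-- If a sunflower with core `K` consists of at most `M` avoided partial assignments of size `k`,
then `K` is avoided as well: assignments in `G` that agree with `K` either agree with no member,
which is rare, or with some member, which is covered by a union bound. -/
theorem IsAvoided.of_sunflower {G : Finset (V → Bool)} {η : ℕ → ℝ}
    {S : Finset (Finset (V × Bool))} {K : Finset (V × Bool)} {k : ℕ} {ε M : ℝ}
    (hKsat : ∃ x, LitSat K x) (hKk : K.card ≤ k) (hη : 0 ≤ η k)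
    (hS : ∀ N ∈ S, N.card = k ∧ IsAvoided G η N) (hM : (S.card : ℝ) ≤ M)
    (hfew : ((Finset.univ.filter fun y : V → Bool => LitSat K y ∧
        (S.filter fun N => LitSat N y).card < 1).card : ℝ) * 2 ^ K.card ≤
        ε * 2 ^ Fintype.card V)
    (hle : ε + M / 2 ^ (k - K.card) * η k ≤ η K.card) :
    IsAvoided G η K := by
  classical
  refine ⟨hKsat, ?_⟩
  have h1 : (G.filter fun y => LitSat K y).card ≤
      (Finset.univ.filter fun y : V → Bool => LitSat K y ∧
        (S.filter fun N => LitSat N y).card < 1).card +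
      ∑ N ∈ S, (G.filter fun y => LitSat N y).card := by
    refine le_trans (Finset.card_le_card (t := (Finset.univ.filter fun y : V → Bool =>
      LitSat K y ∧ (S.filter fun N => LitSat N y).card < 1) ∪
      S.biUnion fun N => G.filter fun y => LitSat N y) ?_) ((Finset.card_union_le _ _).trans
        (Nat.add_le_add_left Finset.card_biUnion_le _))
    intro y hy
    rw [Finset.mem_filter] at hy
    rw [Finset.mem_union]
    by_cases hc : (S.filter fun N => LitSat N y).card < 1
    · exact Or.inl (by simp only [Finset.mem_filter, Finset.mem_univ, true_and]; exact ⟨hy.2, hc⟩)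
    · obtain ⟨N, hN⟩ := Finset.card_pos.1 (not_lt.1 hc)
      rw [Finset.mem_filter] at hN
      exact Or.inr (Finset.mem_biUnion.2 ⟨N, hN.1, Finset.mem_filter.2 ⟨hy.1, hN.2⟩⟩)
  have h2 : ∀ N ∈ S, ((G.filter fun y => LitSat N y).card : ℝ) * 2 ^ K.card ≤
      η k / 2 ^ (k - K.card) * 2 ^ Fintype.card V := by
    intro N hN
    obtain ⟨hNk, -, hav⟩ := hS N hN
    rw [hNk] at hav
    rw [div_mul_eq_mul_div, le_div_iff₀ (by positivity), mul_assoc, ← pow_add,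
      Nat.add_sub_cancel' hKk]
    exact hav
  calc ((G.filter fun y => LitSat K y).card : ℝ) * 2 ^ K.card
      ≤ (((Finset.univ.filter fun y : V → Bool => LitSat K y ∧
        (S.filter fun N => LitSat N y).card < 1).card : ℝ) +
        ∑ N ∈ S, ((G.filter fun y => LitSat N y).card : ℝ)) * 2 ^ K.card := by
        gcongr; exact_mod_cast h1
    _ = ((Finset.univ.filter fun y : V → Bool => LitSat K y ∧
        (S.filter fun N => LitSat N y).card < 1).card : ℝ) * 2 ^ K.card +
        ∑ N ∈ S, ((G.filter fun y => LitSat N y).card : ℝ) * 2 ^ K.card := by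
        rw [add_mul, Finset.sum_mul]
    _ ≤ ε * 2 ^ Fintype.card V + ∑ _N ∈ S, η k / 2 ^ (k - K.card) * 2 ^ Fintype.card V :=
        add_le_add hfew (Finset.sum_le_sum h2)
    _ = (ε + S.card / 2 ^ (k - K.card) * η k) * 2 ^ Fintype.card V := by
        rw [Finset.sum_const, nsmul_eq_mul]; ring
    _ ≤ (ε + M / 2 ^ (k - K.card) * η k) * 2 ^ Fintype.card V := by gcongr
    _ ≤ _ := by gcongr

open Classical in
/-- There are few minimal avoided partial assignments of each size. Otherwise take a largest `K'`
contained in too many of them. Just above the threshold number of these contain a sunflower, whose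
core `K` extends `K'`. The choice of `K'` bounds the number of its members, so `K` is avoided,
which contradicts minimality. -/
theorem card_minimal_isAvoided_le {B : ℝ} (hB : IsRobustSunflowerConstant B)
    {G : Finset (V → Bool)} {η : ℕ → ℝ} {ε κ : ℝ} {d : ℕ} (hd : 1 ≤ d) (hε0 : 0 < ε)
    (hε1 : ε ≤ 1 / 2) (hκ1 : 1 ≤ κ) (hκ : 4 * B * Real.log ((d : ℝ) / ε) ≤ κ) (hη0 : ∀ k, 0 ≤ η k)
    (hη : ∀ k i, k ≤ d → 1 ≤ i → i ≤ k → ε + 2 * d * κ ^ i / 2 ^ i * η k ≤ η (k - i))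
    {k : ℕ} (hk : k ≤ d) :
    ((Finset.univ.filter fun N : Finset (V × Bool) =>
      N.card = k ∧ Minimal (IsAvoided G η) N).card : ℝ) ≤ d * κ ^ k := by
  set 𝓚 := Finset.univ.filter fun N : Finset (V × Bool) =>
      N.card = k ∧ Minimal (IsAvoided G η) N with h𝓚
  have hmem𝓚 : ∀ N ∈ 𝓚, N.card = k ∧ Minimal (IsAvoided G η) N := fun N hN => by
    simpa [h𝓚] using hN
  by_contra hcon
  rw [not_le] at hcon
  obtain ⟨K', hK', hmax⟩ := Finset.exists_max_image
    (Finset.univ.filter fun K : Finset (V × Bool) => K.card ≤ k ∧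
      (d : ℝ) * κ ^ (k - K.card) < ((𝓚.filter fun N => K ⊆ N).card : ℝ)) Finset.card
    ⟨∅, by simpa using hcon⟩
  simp only [Finset.mem_filter, Finset.mem_univ, true_and] at hK' hmax
  obtain ⟨hK'k, hK'c⟩ := hK'
  have hd' : (1 : ℝ) ≤ d := by exact_mod_cast hd
  have hj1 : 1 ≤ k - K'.card := by
    by_contra hj
    have hle : (𝓚.filter fun N => K' ⊆ N).card ≤ 1 := by
      rw [Finset.card_le_one]
      have hu : ∀ N ∈ 𝓚.filter (fun N => K' ⊆ N), K' = N := fun N hN => by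
        rw [Finset.mem_filter] at hN
        exact Finset.eq_of_subset_of_card_le hN.2 (by rw [(hmem𝓚 N hN.1).1]; omega)
      intro a ha b hb
      rw [← hu a ha, ← hu b hb]
    have hle' : ((𝓚.filter fun N => K' ⊆ N).card : ℝ) ≤ 1 := by exact_mod_cast hle
    have : (1 : ℝ) ≤ κ ^ (k - K'.card) := one_le_pow₀ hκ1
    nlinarith
  set j := k - K'.card with hj
  have hjd : j ≤ d := by omega
  have hj' : (1 : ℝ) ≤ j := by exact_mod_cast hj1
  have hjd' : (j : ℝ) ≤ d := by exact_mod_cast hjd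
  have hκj : (1 : ℝ) ≤ κ ^ j := one_le_pow₀ hκ1
  set c := ⌊(d : ℝ) * κ ^ j⌋₊ + 1 with hc
  have hcle : c ≤ (𝓚.filter fun N => K' ⊆ N).card := by
    have : ⌊(d : ℝ) * κ ^ j⌋₊ < (𝓚.filter fun N => K' ⊆ N).card :=
      (Nat.floor_lt (by positivity)).2 hK'c
    omega
  obtain ⟨𝓕, h𝓕, h𝓕c⟩ := Finset.exists_subset_card_eq hcle
  have hmem𝓕 : ∀ N ∈ 𝓕, N ∈ 𝓚 ∧ K' ⊆ N := fun N hN => Finset.mem_filter.1 (h𝓕 hN)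
  have hclow : (d : ℝ) * κ ^ j ≤ c := by
    rw [hc]; push_cast; exact (Nat.lt_floor_add_one _).le
  have hcup : (c : ℝ) ≤ 2 * d * κ ^ j := by
    have h1 : (⌊(d : ℝ) * κ ^ j⌋₊ : ℝ) ≤ d * κ ^ j := Nat.floor_le (by positivity)
    rw [hc]; push_cast
    nlinarith
  have hlog0 : 0 ≤ Real.log ((j : ℝ) / ε) := by
    have := half_le_log_div hj' hε0 hε1
    linarith
  have hlog : Real.log ((j : ℝ) / ε) ≤ Real.log ((d : ℝ) / ε) :=
    Real.log_le_log (by positivity) (by gcongr)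
  obtain ⟨S, K, hS𝓕, hSne, hKsat, hK'K, hKS, hKnS, hfew⟩ := hB.exists_litSat_sunflower (q := 1)
    (ε := ε) (d := j) (𝓝 := 𝓕) (K₀ := K') le_rfl hε0 hε1 hj1
    (Finset.card_pos.1 (by omega))
    (by
      intro N hN
      obtain ⟨h1, h2⟩ := hmem𝓕 N hN
      obtain ⟨h3, h4⟩ := hmem𝓚 N h1
      exact ⟨h2, fun h => by rw [← h] at h3; omega, by omega, h4.prop.1⟩)
    (by
      have hB0 := hB.1
      have h1 : 4 * ((1 : ℕ) : ℝ) * B * Real.log ((j : ℝ) / ε) ≤ κ := by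
        refine le_trans ?_ hκ
        rw [Nat.cast_one, mul_one]
        gcongr
      have h0 : 0 ≤ 4 * ((1 : ℕ) : ℝ) * B * Real.log ((j : ℝ) / ε) := by positivity
      calc (j : ℝ) * (4 * ((1 : ℕ) : ℝ) * B * Real.log ((j : ℝ) / ε)) ^ j ≤ d * κ ^ j := by gcongr
        _ ≤ c := hclow
        _ = _ := by rw [h𝓕c])
  have hSmem : ∀ N ∈ S, N.card = k ∧ Minimal (IsAvoided G η) N := fun N hN =>
    hmem𝓚 N (hmem𝓕 N (hS𝓕 hN)).1
  obtain ⟨N₀, hN₀⟩ := hSne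
  have hKlt : K.card < k := by
    rw [← (hSmem N₀ hN₀).1]
    refine Finset.card_lt_card ((hKS N₀ hN₀).ssubset_of_ne ?_)
    rintro rfl
    exact hKnS hN₀
  have hScard : (S.card : ℝ) ≤ 2 * d * κ ^ (k - K.card) := by
    by_cases hKK : K.card ≤ K'.card
    · have h1 : K' = K := Finset.eq_of_subset_of_card_le hK'K hKK
      rw [← h1]
      refine le_trans ?_ hcup
      rw [← h𝓕c]
      exact_mod_cast Finset.card_le_card hS𝓕
    · have h1 : ((𝓚.filter fun N => K ⊆ N).card : ℝ) ≤ d * κ ^ (k - K.card) := by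
        by_contra hlt
        exact hKK (hmax K ⟨hKlt.le, not_le.1 hlt⟩)
      have h2 : S.card ≤ (𝓚.filter fun N => K ⊆ N).card :=
        Finset.card_le_card fun N hN => Finset.mem_filter.2 ⟨(hmem𝓕 N (hS𝓕 hN)).1, hKS N hN⟩
      have h3 : (S.card : ℝ) ≤ (𝓚.filter fun N => K ⊆ N).card := by exact_mod_cast h2
      have h4 : (1 : ℝ) ≤ κ ^ (k - K.card) := one_le_pow₀ hκ1
      nlinarith
  have hKav : IsAvoided G η K := by
    refine IsAvoided.of_sunflower (k := k) (ε := ε) hKsat hKlt.le (hη0 k)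
      (fun N hN => ⟨(hSmem N hN).1, (hSmem N hN).2.prop⟩) hScard ?_ ?_
    · rwa [Nat.cast_one, one_mul] at hfew
    · have := hη k (k - K.card) hk (by omega) (by omega)
      rwa [show k - (k - K.card) = K.card by omega] at this
  have hle := (hSmem N₀ hN₀).2.le_of_le hKav (hKS N₀ hN₀)
  have := Finset.card_le_card hle
  rw [(hSmem N₀ hN₀).1] at this
  omega

/-- Few assignments in `G` agree with an avoided partial assignment of size at most `d`. -/
theorem card_exists_isAvoided_le {B : ℝ} (hB : IsRobustSunflowerConstant B)
    {G H : Finset (V → Bool)} {η : ℕ → ℝ} {ε κ : ℝ} {d : ℕ} (hd : 1 ≤ d) (hε0 : 0 < ε)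
    (hε1 : ε ≤ 1 / 2) (hκ1 : 1 ≤ κ) (hκ : 4 * B * Real.log ((d : ℝ) / ε) ≤ κ) (hη0 : ∀ k, 0 ≤ η k)
    (hη : ∀ k i, k ≤ d → 1 ≤ i → i ≤ k → ε + 2 * d * κ ^ i / 2 ^ i * η k ≤ η (k - i))
    (hHG : H ⊆ G)
    (hH : ∀ y ∈ H, ∃ K : Finset (V × Bool), K.card ≤ d ∧ IsAvoided G η K ∧ LitSat K y) :
    (H.card : ℝ) ≤ (∑ k ∈ Finset.range (d + 1), d * κ ^ k * η k) * 2 ^ Fintype.card V := by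
  classical
  set 𝓚 : ℕ → Finset (Finset (V × Bool)) := fun k => Finset.univ.filter fun N =>
      N.card = k ∧ Minimal (IsAvoided G η) N with h𝓚
  have h1 : H ⊆ (Finset.range (d + 1)).biUnion fun k => (𝓚 k).biUnion fun N =>
      G.filter fun y => LitSat N y := by
    intro y hy
    obtain ⟨K, hKd, hKav, hKy⟩ := hH y hy
    obtain ⟨N, hNK, hN⟩ := exists_minimal_le_of_wellFoundedLT _ K hKav
    have := Finset.card_le_card hNK
    refine Finset.mem_biUnion.2 ⟨N.card, Finset.mem_range.2 (by omega),
      Finset.mem_biUnion.2 ⟨N, ?_, Finset.mem_filter.2 ⟨hHG hy, hKy.mono hNK⟩⟩⟩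
    simp [h𝓚, hN]
  have h2 : H.card ≤ ∑ k ∈ Finset.range (d + 1), ∑ N ∈ 𝓚 k, (G.filter fun y => LitSat N y).card :=
    (Finset.card_le_card h1).trans (Finset.card_biUnion_le.trans
      (Finset.sum_le_sum fun k _ => Finset.card_biUnion_le))
  calc (H.card : ℝ) ≤ ∑ k ∈ Finset.range (d + 1), ∑ N ∈ 𝓚 k,
        ((G.filter fun y => LitSat N y).card : ℝ) := by exact_mod_cast h2
    _ ≤ ∑ k ∈ Finset.range (d + 1), d * κ ^ k * η k * 2 ^ Fintype.card V := by
        refine Finset.sum_le_sum fun k hk => ?_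
        have hkd : k ≤ d := Nat.lt_succ_iff.1 (Finset.mem_range.1 hk)
        have hcard := card_minimal_isAvoided_le hB hd hε0 hε1 hκ1 hκ hη0 hη hkd (G := G)
        calc ∑ N ∈ 𝓚 k, ((G.filter fun y => LitSat N y).card : ℝ)
            ≤ ∑ _N ∈ 𝓚 k, η k * 2 ^ Fintype.card V := by
              refine Finset.sum_le_sum fun N hN => ?_
              simp only [h𝓚, Finset.mem_filter, Finset.mem_univ, true_and] at hN
              have h3 := hN.2.prop.2
              rw [hN.1] at h3
              refine le_trans (le_mul_of_one_le_right (by positivity) ?_) h3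
              exact one_le_pow₀ (by norm_num)
          _ = (𝓚 k).card * (η k * 2 ^ Fintype.card V) := by
              rw [Finset.sum_const, nsmul_eq_mul]
          _ ≤ d * κ ^ k * (η k * 2 ^ Fintype.card V) := by
              have := hη0 k
              gcongr
          _ = _ := by ring
    _ = _ := by rw [Finset.sum_mul]

end Avoided

/-! ### Statistical distance and distinguishing events -/

theorem prob_eq_sum {Ω : Type*} [Fintype Ω] (P : PMF Ω) (E : Set Ω) [DecidablePred (· ∈ E)] :
    prob P E = ∑ a, if a ∈ E then (P a).toReal else 0 := by
  unfold prob
  rw [PMF.toOuterMeasure_apply_fintype, ENNReal.toReal_sum]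
  · refine Finset.sum_congr rfl fun a _ => ?_
    rw [Set.indicator_apply]
    split_ifs <;> simp
  · intro a _
    rw [Set.indicator_apply]
    split_ifs
    · exact P.apply_ne_top a
    · simp

theorem PMF.sum_toReal {Ω : Type*} [Fintype Ω] (P : PMF Ω) : ∑ a, (P a).toReal = 1 := by
  rw [← ENNReal.toReal_sum fun a _ => P.apply_ne_top a, ← tsum_fintype (L := .unconditional Ω),
    P.tsum_coe, ENNReal.toReal_one]

theorem prob_union_le {Ω : Type*} [Fintype Ω] (P : PMF Ω) (E E' : Set Ω) :
    prob P (E ∪ E') ≤ prob P E + prob P E' := by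
  classical
  rw [prob_eq_sum, prob_eq_sum, prob_eq_sum, ← Finset.sum_add_distrib]
  refine Finset.sum_le_sum fun a _ => ?_
  have := ENNReal.toReal_nonneg (a := P a)
  by_cases h : a ∈ E <;> by_cases h' : a ∈ E' <;> simp [h, h', this]

theorem prob_sub_prob_le_statDist {Ω : Type*} [Fintype Ω] (P Q : PMF Ω) (E : Set Ω) :
    prob P E - prob Q E ≤ statDist P Q := by
  classical
  have h0 : ∑ a, ((P a).toReal - (Q a).toReal) = 0 := by
    rw [Finset.sum_sub_distrib, P.sum_toReal, Q.sum_toReal, sub_self]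
  have h1 : 2 * (prob P E - prob Q E) =
      ∑ a, (if a ∈ E then ((P a).toReal - (Q a).toReal) else -((P a).toReal - (Q a).toReal)) := by
    rw [prob_eq_sum, prob_eq_sum, ← Finset.sum_sub_distrib, ← add_zero (2 * _), ← neg_zero, ← h0,
      Finset.mul_sum, ← Finset.sum_neg_distrib, ← Finset.sum_add_distrib]
    refine Finset.sum_congr rfl fun a _ => ?_
    split_ifs <;> ring
  have h2 : 2 * (prob P E - prob Q E) ≤ ∑ a, |(P a).toReal - (Q a).toReal| := by
    rw [h1]
    refine Finset.sum_le_sum fun a _ => ?_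
    split_ifs
    · exact le_abs_self _
    · exact neg_le_abs _
  unfold statDist
  linarith

theorem prob_sourceLaw {m n : ℕ} (X : (Fin m → Bool) → (Fin n → Bool)) (E : Set (Fin n → Bool))
    [DecidablePred fun y => X y ∈ E] :
    prob (sourceLaw X) E = ((Finset.univ.filter fun y => X y ∈ E).card : ℝ) / 2 ^ m := by
  classical
  unfold prob sourceLaw
  rw [PMF.toOuterMeasure_map_apply, PMF.toOuterMeasure_uniformOfFintype_apply,
    ENNReal.toReal_div, Fintype.card_fun]
  have h : Fintype.card (X ⁻¹' E) = (Finset.univ.filter fun y => X y ∈ E).card := by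
    rw [← Set.toFinset_card]
    congr 1
    ext y
    simp
  simp [h]

/-! ### Outputs with a term that contains no avoided partial assignment -/

theorem ComputedByDNF.exists_literals {m s d : ℕ} {f : (Fin m → Bool) → Bool}
    (hf : ComputedByDNF s d f) :
    ∃ 𝒯 : Set (Finset (Fin m × Bool)), (∀ N ∈ 𝒯, N.card ≤ d ∧ ∃ x, LitSat N x) ∧
      ∀ y, f y = true ↔ ∃ N ∈ 𝒯, LitSat N y := by
  obtain ⟨φ, -, hd, hφ⟩ := hf
  have hsat : ∀ (τ : DNFTerm m) y, LitSat (τ.dom.image fun j => (j, τ.val j)) y ↔ τ.Sat y :=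
    fun τ y => litSat_image τ.dom
  refine ⟨{N | ∃ τ ∈ φ, N = τ.dom.image fun j => (j, τ.val j)}, ?_, ?_⟩
  · rintro N ⟨τ, hτ, rfl⟩
    exact ⟨(card_image_graph τ.val τ.dom).le.trans (hd τ hτ),
      τ.val, (hsat τ _).2 fun _ _ => rfl⟩
  · intro y
    rw [hφ]
    constructor
    · rintro ⟨τ, hτ, hy⟩
      exact ⟨_, ⟨τ, hτ, rfl⟩, (hsat τ y).2 hy⟩
    · rintro ⟨_, ⟨τ, hτ, rfl⟩, hy⟩
      exact ⟨τ, hτ, (hsat τ y).1 hy⟩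

open Classical in
/-- Let `G` be the set of inputs whose output has weight at most `t`. At most half of the outputs
have a term containing no partial assignment avoided by `G`. Otherwise choose such terms. No term
belongs to more than `t` outputs, as it would be avoided itself, so there are many distinct ones,
and they contain a sunflower. With high probability, an input agreeing with its core satisfies
more than `t` of the chosen terms, so the core is avoided. -/
theorem two_mul_card_unavoided_le {B : ℝ} (hB : IsRobustSunflowerConstant B) {V : Type} [Fintype V]
    [DecidableEq V] {n d t : ℕ} {X : (V → Bool) → (Fin n → Bool)}
    {𝒯 : Fin n → Set (Finset (V × Bool))} {G : Finset (V → Bool)} {η : ℕ → ℝ} {ε : ℝ}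
    (h𝒯 : ∀ i, ∀ N ∈ 𝒯 i, N.card ≤ d ∧ ∃ x, LitSat N x)
    (hX : ∀ i y, (∃ N ∈ 𝒯 i, LitSat N y) → X y i = true)
    (hG : ∀ y ∈ G, hammingWeight (X y) ≤ t)
    (hd : 1 ≤ d) (hε0 : 0 < ε) (hε1 : ε ≤ 1 / 2) (hη0 : ∀ k, 0 ≤ η k)
    (hη : ∀ k, k ≤ d → (t + 1) * ε ≤ η k)
    (hn : 2 * t * (1 + d * (4 * (t + 1) * B * Real.log ((d : ℝ) / ε)) ^ d) ≤ (n : ℝ)) :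
    2 * (Finset.univ.filter fun i => ∃ N ∈ 𝒯 i, ∀ K, K ⊆ N → ¬ IsAvoided G η K).card ≤ n := by
  set A := Finset.univ.filter fun i => ∃ N ∈ 𝒯 i, ∀ K, K ⊆ N → ¬ IsAvoided G η K with hA
  by_contra hcon
  have hN : ∀ i, ∃ N, i ∈ A → N ∈ 𝒯 i ∧ ∀ K, K ⊆ N → ¬ IsAvoided G η K := by
    intro i
    by_cases hi : i ∈ A
    · have := hi
      rw [hA, Finset.mem_filter] at this
      obtain ⟨N, h1, h2⟩ := this.2
      exact ⟨N, fun _ => ⟨h1, h2⟩⟩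
    · exact ⟨∅, fun h => absurd h hi⟩
  choose N hN using hN
  -- The outputs whose chosen term is satisfied are equal to one.
  have hweight : ∀ y ∈ G, (A.filter fun i => LitSat (N i) y).card ≤ t := by
    intro y hy
    refine le_trans (Finset.card_le_card fun i hi => ?_) (hG y hy)
    rw [Finset.mem_filter] at hi ⊢
    exact ⟨Finset.mem_univ _, hX i y ⟨N i, (hN i hi.1).1, hi.2⟩⟩
  set 𝓝 := A.image N with h𝓝
  have hfib : ∀ M ∈ 𝓝, (A.filter fun i => N i = M).card ≤ t := by
    intro M hM
    obtain ⟨i, hi, rfl⟩ := Finset.mem_image.1 hM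
    by_contra hlt
    refine (hN i hi).2 (N i) subset_rfl ⟨(h𝒯 i _ (hN i hi).1).2, ?_⟩
    have hempty : (G.filter fun y => LitSat (N i) y) = ∅ := by
      rw [Finset.filter_eq_empty_iff]
      intro y hy hs
      refine hlt (le_trans (Finset.card_le_card fun k hk => ?_) (hweight y hy))
      rw [Finset.mem_filter] at hk ⊢
      exact ⟨hk.1, hk.2 ▸ hs⟩
    rw [hempty]
    have := hη0 (N i).card
    simp only [Finset.card_empty, Nat.cast_zero, zero_mul]
    positivity
  have hA𝓝 : A.card ≤ t * 𝓝.card :=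
    Finset.card_le_mul_card_image A t hfib
  set 𝓜 := 𝓝.erase ∅ with h𝓜
  have h𝓜c : 𝓝.card ≤ 𝓜.card + 1 := by
    have := Finset.pred_card_le_card_erase (s := 𝓝) (a := ∅)
    rw [← h𝓜] at this
    omega
  have hbig : (d : ℝ) * (4 * (t + 1) * B * Real.log ((d : ℝ) / ε)) ^ d < 𝓜.card := by
    have h1 : n < 2 * (t * (𝓜.card + 1)) :=
      lt_of_lt_of_le (not_le.1 hcon)
        (Nat.mul_le_mul_left 2 (hA𝓝.trans (Nat.mul_le_mul_left t h𝓜c)))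
    have h2 : (n : ℝ) < 2 * (t * (𝓜.card + 1)) := by exact_mod_cast h1
    have h3 : (0 : ℝ) ≤ t := by positivity
    by_contra hle
    rw [not_lt] at hle
    have := mul_le_mul_of_nonneg_left hle h3
    nlinarith
  have hL := half_le_log_div (show (1 : ℝ) ≤ d by exact_mod_cast hd) hε0 hε1
  have hB0 := hB.1
  have h𝓜0 : 0 < 𝓜.card := by
    have : (0 : ℝ) < 𝓜.card := lt_of_le_of_lt (by positivity) hbig
    exact_mod_cast this
  have hmem𝓜 : ∀ M ∈ 𝓜, ∃ i ∈ A, N i = M := fun M hM =>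
    Finset.mem_image.1 (Finset.mem_of_mem_erase hM)
  obtain ⟨S, K, hS, hSne, hKsat, -, hKS, -, hfew⟩ := hB.exists_litSat_sunflower (q := t + 1)
    (ε := ε) (d := d) (𝓝 := 𝓜) (K₀ := ∅) (by omega) hε0 hε1 hd (Finset.card_pos.1 h𝓜0)
    (by
      intro M hM
      obtain ⟨i, hi, rfl⟩ := hmem𝓜 M hM
      obtain ⟨h1, h2⟩ := h𝒯 i _ (hN i hi).1
      exact ⟨Finset.empty_subset _, (Finset.ne_of_mem_erase hM).symm, by simpa using h1, h2⟩)
    (by push_cast; exact hbig.le)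
  have hcore : ∀ M ∈ S, ∃ i ∈ A, N i = M := fun M hM => hmem𝓜 M (hS hM)
  obtain ⟨M₀, hM₀⟩ := hSne
  obtain ⟨i, hi, rfl⟩ := hcore M₀ hM₀
  have hKd : K.card ≤ d :=
    (Finset.card_le_card (hKS _ hM₀)).trans (h𝒯 i _ (hN i hi).1).1
  refine (hN i hi).2 K (hKS _ hM₀) ⟨hKsat, ?_⟩
  have hsub : (G.filter fun y => LitSat K y) ⊆ Finset.univ.filter fun y : V → Bool =>
      LitSat K y ∧ (S.filter fun M => LitSat M y).card < t + 1 := by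
    intro y hy
    rw [Finset.mem_filter] at hy ⊢
    refine ⟨Finset.mem_univ _, hy.2, Nat.lt_succ_of_le (le_trans ?_ (hweight y hy.1))⟩
    refine le_trans (Finset.card_le_card (t := (A.filter fun i => LitSat (N i) y).image N)
      fun M hM => ?_) Finset.card_image_le
    rw [Finset.mem_filter] at hM
    obtain ⟨k, hk, rfl⟩ := hcore M hM.1
    exact Finset.mem_image_of_mem _ (Finset.mem_filter.2 ⟨hk, hM.2⟩)
  calc ((G.filter fun y => LitSat K y).card : ℝ) * 2 ^ K.card
      ≤ ((Finset.univ.filter fun y : V → Bool =>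
        LitSat K y ∧ (S.filter fun M => LitSat M y).card < t + 1).card : ℝ) * 2 ^ K.card := by
        gcongr
    _ ≤ ((t + 1 : ℕ) : ℝ) * ε * 2 ^ Fintype.card V := hfew
    _ ≤ η K.card * 2 ^ Fintype.card V := by
        gcongr
        push_cast
        exact hη _ hKd

/-! ### Parameters -/

/-- A single set is not a robust sunflower, which bounds robust sunflower constants from below. -/
theorem IsRobustSunflowerConstant.half_lt_mul_log_two {B : ℝ} (hB : IsRobustSunflowerConstant B) :
    1 / 2 < B * Real.log 2 := by
  by_contra hle
  rw [not_lt] at hle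
  obtain ⟨S, hS, hrob⟩ := hB.2 Unit (1 / 2) (1 / 2) 1 {Finset.univ} (by norm_num) le_rfl
    (by norm_num) le_rfl le_rfl (by simp)
    (by
      simp only [Nat.cast_one, one_mul, pow_one, Finset.card_singleton]
      rw [show (1 : ℝ) / (1 / 2) = 2 by norm_num]
      linarith)
  obtain ⟨N, hN⟩ := hrob.nonempty (by norm_num)
  have hNu : S = {N} := by
    have h1 : ∀ M ∈ S, M = Finset.univ := fun M hM => by simpa using hS hM
    ext M
    rw [Finset.mem_singleton]
    exact ⟨fun hM => (h1 M hM).trans (h1 N hN).symm, fun h => h ▸ hN⟩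
  refine hrob.1 ?_
  rw [hNu]
  simp [sunflowerKernel]

section Parameters

variable {B : ℝ} {n d t : ℕ}

theorem one_add_pow_le_add_pow {a : ℝ} (ha : 0 ≤ a) {b : ℝ} (hb : 1 ≤ b) {d : ℕ} (hd : 1 ≤ d) :
    1 + a ^ d ≤ (a + b) ^ d := by
  have h1 : a ^ d + b ^ d ≤ (a + b) ^ d := pow_add_pow_le ha (by linarith) (by omega)
  have h2 : 1 ≤ b ^ d := one_le_pow₀ hb
  linarith

theorem half_lt_mul_log (hB : 1 / 2 < B * Real.log 2) (hB0 : 0 < B) (hn : 2 ≤ n) :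
    1 / 2 < B * Real.log n := by
  refine lt_of_lt_of_le hB ?_
  have : Real.log 2 ≤ Real.log n := Real.log_le_log (by norm_num) (by exact_mod_cast hn)
  gcongr

theorem twenty_le_base (hB : 1 / 2 < B * Real.log 2) (hB0 : 0 < B) (hn : 2 ≤ n) (ht : 1 ≤ t) :
    20 ≤ 40 * B * t * Real.log n := by
  have h1 := half_lt_mul_log hB hB0 hn
  have h2 : (1 : ℝ) ≤ t := by exact_mod_cast ht
  nlinarith

theorem two_mul_mul_twenty_pow_le (hB : 1 / 2 < B * Real.log 2) (hB0 : 0 < B) (hn : 2 ≤ n)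
    (ht : 1 ≤ t)
    (h : 2 * (d : ℝ) * (t : ℝ) * (40 * B * (t : ℝ) * Real.log (n : ℝ)) ^ d ≤ (n : ℝ)) :
    2 * (d : ℝ) * t * 20 ^ d ≤ n := by
  refine le_trans ?_ h
  gcongr
  exact twenty_le_base hB hB0 hn ht

theorem threshold_add_one_le (hB : 1 / 2 < B * Real.log 2) (hB0 : 0 < B) (hn : 2 ≤ n)
    (hd : 1 ≤ d) (ht : 1 ≤ t)
    (h : 2 * (d : ℝ) * (t : ℝ) * (40 * B * (t : ℝ) * Real.log (n : ℝ)) ^ d ≤ (n : ℝ)) :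
    (t : ℝ) + 1 ≤ n := by
  have h1 := two_mul_mul_twenty_pow_le hB hB0 hn ht h
  have h2 : (1 : ℝ) ≤ d := by exact_mod_cast hd
  have h3 : (1 : ℝ) ≤ t := by exact_mod_cast ht
  have h4 : (1 : ℝ) ≤ 20 ^ d := one_le_pow₀ (by norm_num)
  have h5 : (t : ℝ) ≤ d * t := by nlinarith
  have h6 : (d : ℝ) * t ≤ d * t * 20 ^ d := by
    have : (0 : ℝ) ≤ d * t := by positivity
    nlinarith
  nlinarith

/-- The error `n ^ (-4)` is used for all sunflowers. As `d ^ 2 ≤ n`, the width adds at most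
`log n / 2` to its logarithm. -/
theorem log_width_div_le (hB : 1 / 2 < B * Real.log 2) (hB0 : 0 < B) (hn : 2 ≤ n)
    (hd : 1 ≤ d) (ht : 1 ≤ t)
    (h : 2 * (d : ℝ) * (t : ℝ) * (40 * B * (t : ℝ) * Real.log (n : ℝ)) ^ d ≤ (n : ℝ)) :
    Real.log ((d : ℝ) / (1 / (n : ℝ) ^ 4)) ≤ 9 / 2 * Real.log n := by
  have h1 := two_mul_mul_twenty_pow_le hB hB0 hn ht h
  have h2 : (1 : ℝ) ≤ d := by exact_mod_cast hd
  have h3 : (1 : ℝ) ≤ t := by exact_mod_cast ht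
  have hn0 : (0 : ℝ) < n := by exact_mod_cast (by omega : 0 < n)
  have h4 : (d : ℝ) ≤ 20 ^ d := by exact_mod_cast (Nat.lt_pow_self (by norm_num : 1 < 20)).le
  have h5 : (d : ℝ) ^ 2 ≤ n := by
    have h6 : (d : ℝ) ≤ d * t := by nlinarith
    have h7 : (d : ℝ) * d ≤ (d * t) * 20 ^ d := by gcongr
    nlinarith [show (0 : ℝ) ≤ d * d by positivity]
  have h8 : 2 * Real.log d ≤ Real.log n := by
    have := Real.log_le_log (by positivity) h5
    rwa [Real.log_pow, Nat.cast_ofNat] at this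
  rw [div_div_eq_mul_div, div_one, Real.log_mul (by positivity) (by positivity), Real.log_pow]
  push_cast
  linarith

/-- More than half of the outputs provide enough distinct non-empty terms for a sunflower. The gap
between the constants `36` and `40` pays for a possibly chosen empty term. -/
theorem sunflower_threshold_le (hB : 1 / 2 < B * Real.log 2) (hB0 : 0 < B) (hn : 2 ≤ n)
    (hd : 1 ≤ d) (ht : 1 ≤ t)
    (h : 2 * (d : ℝ) * (t : ℝ) * (40 * B * (t : ℝ) * Real.log (n : ℝ)) ^ d ≤ (n : ℝ))
    (hL0 : 0 ≤ Real.log ((d : ℝ) / (1 / (n : ℝ) ^ 4))) :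
    2 * (t : ℝ) * (1 + d * (4 * (t + 1) * B * Real.log ((d : ℝ) / (1 / (n : ℝ) ^ 4))) ^ d) ≤ n := by
  have hL := log_width_div_le hB hB0 hn hd ht h
  have h2 : (1 : ℝ) ≤ d := by exact_mod_cast hd
  have h3 : (1 : ℝ) ≤ t := by exact_mod_cast ht
  have hu := half_lt_mul_log hB hB0 hn
  have hlogn : 0 ≤ Real.log n := Real.log_natCast_nonneg n
  have h4 : 4 * ((t : ℝ) + 1) * B * Real.log ((d : ℝ) / (1 / (n : ℝ) ^ 4)) ≤
      36 * B * t * Real.log n := by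
    calc 4 * ((t : ℝ) + 1) * B * Real.log ((d : ℝ) / (1 / (n : ℝ) ^ 4))
        ≤ 4 * (t + t) * B * (9 / 2 * Real.log n) := by gcongr
      _ = _ := by ring
  have h5 : 1 ≤ 4 * B * t * Real.log n := by nlinarith
  have h6 := one_add_pow_le_add_pow (a := 36 * B * t * Real.log n) (by positivity) h5 hd
  rw [show 36 * B * t * Real.log n + 4 * B * t * Real.log n = 40 * B * t * Real.log n by ring] at h6
  calc 2 * (t : ℝ) * (1 + d * (4 * (t + 1) * B * Real.log ((d : ℝ) / (1 / (n : ℝ) ^ 4))) ^ d)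
      ≤ 2 * t * (d * 1 + d * (36 * B * t * Real.log n) ^ d) := by
        gcongr
        linarith
    _ = 2 * d * t * (1 + (36 * B * t * Real.log n) ^ d) := by ring
    _ ≤ 2 * d * t * (40 * B * t * Real.log n) ^ d := by gcongr
    _ ≤ n := h

/-- The total weight of the minimal avoided partial assignments is small compared with the
probability `n ^ (-3)` allowed for those of size `d`. -/
theorem total_mass_le (hB : 1 / 2 < B * Real.log 2) (hB0 : 0 < B) (hn : 2 ≤ n)
    (hd : 1 ≤ d) (ht : 1 ≤ t)
    (h : 2 * (d : ℝ) * (t : ℝ) * (40 * B * (t : ℝ) * Real.log (n : ℝ)) ^ d ≤ (n : ℝ)) :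
    (2 * (d : ℝ)) ^ 2 * (2 * d * (18 * B * Real.log n)) ^ d ≤ (n : ℝ) ^ 2 := by
  have h1 := two_mul_mul_twenty_pow_le hB hB0 hn ht h
  have h2 : (1 : ℝ) ≤ d := by exact_mod_cast hd
  have h3 : (1 : ℝ) ≤ t := by exact_mod_cast ht
  have hn0 : (0 : ℝ) < n := by exact_mod_cast (by omega : 0 < n)
  have hlogn : 0 ≤ Real.log n := Real.log_natCast_nonneg n
  -- The width is at most `log n`, hence at most the base of the power in the hypothesis.
  have hdlog : (d : ℝ) ≤ Real.log n := by
    rw [Real.le_log_iff_exp_le hn0]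
    calc Real.exp d = Real.exp 1 ^ d := by rw [← Real.exp_nat_mul, mul_one]
      _ ≤ 20 ^ d := by gcongr; linarith [Real.exp_one_lt_three]
      _ ≤ 2 * d * t * 20 ^ d := le_mul_of_one_le_left (by positivity) (by nlinarith)
      _ ≤ n := h1
  have hB1 : 1 ≤ 40 * B := by
    have := Real.log_two_lt_d9
    nlinarith
  set Λ := 40 * B * t * Real.log n with hΛ
  have hBlog : 36 * B * Real.log n ≤ Λ := by
    have : 0 ≤ B * Real.log n := by positivity
    rw [hΛ]; nlinarith
  have hdΛ : (d : ℝ) ≤ Λ := by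
    refine hdlog.trans ?_
    rw [hΛ]
    exact le_mul_of_one_le_left hlogn (by nlinarith)
  have hbase : 2 * (d : ℝ) * (18 * B * Real.log n) ≤ Λ * Λ := by
    calc 2 * (d : ℝ) * (18 * B * Real.log n) = d * (36 * B * Real.log n) := by ring
      _ ≤ Λ * Λ := by gcongr
  have hΛ0 : 0 ≤ Λ := by positivity
  have h4 : 2 * d * Λ ^ d ≤ n := by
    refine le_trans ?_ h
    have : (0 : ℝ) ≤ 2 * d * Λ ^ d := by positivity
    nlinarith
  calc (2 * (d : ℝ)) ^ 2 * (2 * d * (18 * B * Real.log n)) ^ d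
      ≤ (2 * (d : ℝ)) ^ 2 * (Λ * Λ) ^ d := by gcongr
    _ = (2 * d * Λ ^ d) ^ 2 := by rw [mul_pow Λ Λ]; ring
    _ ≤ _ := by gcongr

end Parameters

/-! ### The lower bound for samplers -/

/-- The source has a set `T` of at least half of its coordinates that, up to probability
`1 / 2n`, vanishes whenever the output has weight at most `t`. -/
theorem exists_half_vanishing {B : ℝ} (hB : IsRobustSunflowerConstant B) {m n s d t : ℕ}
    {X : (Fin m → Bool) → (Fin n → Bool)} (hn : 2 ≤ n) (hd : 1 ≤ d) (ht : 1 ≤ t)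
    (hX : ∀ i : Fin n, ComputedByDNF s d (fun y => X y i))
    (h : 2 * (d : ℝ) * (t : ℝ) * (40 * B * (t : ℝ) * Real.log (n : ℝ)) ^ d ≤ (n : ℝ)) :
    ∃ T : Finset (Fin n), (n : ℝ) / 2 ≤ T.card ∧
      ((Finset.univ.filter fun y => hammingWeight (X y) ≤ t ∧ ∃ i ∈ T, X y i = true).card : ℝ) ≤
        1 / (2 * (n : ℝ)) * 2 ^ m := by
  classical
  have hB0 := hB.1
  have hB2 := hB.half_lt_mul_log_two
  have hn0 : (0 : ℝ) < n := by exact_mod_cast (by omega : 0 < n)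
  have hn2 : (2 : ℝ) ≤ n := by exact_mod_cast hn
  have hd1 : (1 : ℝ) ≤ d := by exact_mod_cast hd
  obtain ⟨ε, hε⟩ : ∃ ε : ℝ, ε = 1 / (n : ℝ) ^ 4 := ⟨_, rfl⟩
  have hε0 : 0 < ε := by rw [hε]; positivity
  have hεn : n * ε = ((n : ℝ) ^ 3)⁻¹ := by rw [hε]; field_simp
  have hn3 : (0 : ℝ) < ((n : ℝ) ^ 3)⁻¹ := by positivity
  have hε3 : 2 * ε ≤ ((n : ℝ) ^ 3)⁻¹ := by
    rw [← hεn]; gcongr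
  have hε1 : ε ≤ 1 / 2 := by
    have : ((n : ℝ) ^ 3)⁻¹ ≤ 1 := inv_le_one_of_one_le₀ (one_le_pow₀ (by linarith))
    linarith
  obtain ⟨κ, hκ⟩ : ∃ κ : ℝ, κ = 18 * B * Real.log n := ⟨_, rfl⟩
  have hκ1 : 1 ≤ κ := by
    have := half_lt_mul_log hB2 hB0 hn
    rw [hκ]; linarith
  have hlog := log_width_div_le hB2 hB0 hn hd ht h
  rw [← hε] at hlog
  have hlog0 := half_le_log_div hd1 hε0 hε1
  have hκL : 4 * B * Real.log ((d : ℝ) / ε) ≤ κ := by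
    rw [hκ]; nlinarith
  have hdκ : 1 ≤ 2 * d * κ := by nlinarith
  -- The thresholds grow as the size decreases, to absorb the union bound over a sunflower.
  obtain ⟨η, hη⟩ : ∃ η : ℕ → ℝ, ∀ k, η k = ((n : ℝ) ^ 3)⁻¹ * (2 * d * κ) ^ (d - k) :=
    ⟨_, fun _ => rfl⟩
  have hηlow : ∀ k, ((n : ℝ) ^ 3)⁻¹ ≤ η k := fun k => by
    rw [hη]; exact le_mul_of_one_le_right hn3.le (one_le_pow₀ hdκ)
  have hη0 : ∀ k, 0 ≤ η k := fun k => hn3.le.trans (hηlow k)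
  have hηstep : ∀ k i, k ≤ d → 1 ≤ i → i ≤ k →
      ε + 2 * d * κ ^ i / 2 ^ i * η k ≤ η (k - i) := by
    intro k i hk hi hik
    have e1 : η (k - i) = (2 * d * κ) ^ i * η k := by
      rw [hη, hη, show d - (k - i) = i + (d - k) by omega, pow_add]; ring
    have h1 : 2 * d * κ ^ i / 2 ^ i ≤ (2 * d * κ) ^ i / 2 := by
      obtain ⟨j, rfl⟩ : ∃ j, i = j + 1 := ⟨i - 1, by omega⟩
      rw [div_le_iff₀ (by positivity), mul_pow, pow_succ (2 : ℝ) j]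
      have h2 : 2 * (d : ℝ) ≤ (2 * d) ^ (j + 1) := le_self_pow₀ (by linarith) (by omega)
      have h3 : (1 : ℝ) ≤ 2 ^ j := one_le_pow₀ (by norm_num)
      calc 2 * d * κ ^ (j + 1) ≤ (2 * d) ^ (j + 1) * κ ^ (j + 1) * 2 ^ j := by
            have : 0 ≤ (2 * (d : ℝ)) ^ (j + 1) * κ ^ (j + 1) := by positivity
            calc 2 * d * κ ^ (j + 1) ≤ (2 * d) ^ (j + 1) * κ ^ (j + 1) := by gcongr
              _ ≤ _ := le_mul_of_one_le_right this h3
        _ = _ := by ring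
    have h4 : ε ≤ (2 * d * κ) ^ i * η k / 2 := by
      have := le_mul_of_one_le_left (hη0 k) (one_le_pow₀ (n := i) hdκ)
      have := hηlow k
      linarith
    have h5 := mul_le_mul_of_nonneg_right h1 (hη0 k)
    rw [e1]; linarith
  have hηt : ∀ k, k ≤ d → ((t : ℝ) + 1) * ε ≤ η k := by
    intro k _
    refine le_trans ?_ (hηlow k)
    rw [← hεn]
    gcongr
    exact threshold_add_one_le hB2 hB0 hn hd ht h
  choose 𝒯 h𝒯 h𝒯X using fun i => (hX i).exists_literals
  set G : Finset (Fin m → Bool) := Finset.univ.filter fun y => hammingWeight (X y) ≤ t with hG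
  have hhalf := two_mul_card_unavoided_le hB (X := X) (𝒯 := 𝒯) (G := G) (η := η) (t := t) h𝒯
    (fun i y => (h𝒯X i y).2) (fun y hy => (Finset.mem_filter.1 hy).2) hd hε0 hε1 hη0 hηt
    (by
      have := sunflower_threshold_le hB2 hB0 hn hd ht h
      rw [← hε] at this
      exact this (by linarith))
  set A := Finset.univ.filter fun i => ∃ N ∈ 𝒯 i, ∀ K, K ⊆ N → ¬ IsAvoided G η K with hA
  refine ⟨Aᶜ, ?_, ?_⟩
  · have h1 : A.card + Aᶜ.card = n := by rw [Finset.card_add_card_compl, Fintype.card_fin]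
    have h2 : (A.card : ℝ) + Aᶜ.card = n := by exact_mod_cast h1
    have h3 : 2 * (A.card : ℝ) ≤ n := by exact_mod_cast hhalf
    linarith
  · set H := Finset.univ.filter fun y => hammingWeight (X y) ≤ t ∧ ∃ i ∈ Aᶜ, X y i = true with hH
    have hHG : H ⊆ G := fun y hy =>
      Finset.mem_filter.2 ⟨Finset.mem_univ _, (Finset.mem_filter.1 hy).2.1⟩
    have hHK : ∀ y ∈ H, ∃ K : Finset (Fin m × Bool),
        K.card ≤ d ∧ IsAvoided G η K ∧ LitSat K y := by
      intro y hy
      obtain ⟨-, i, hi, hyi⟩ := (Finset.mem_filter.1 hy).2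
      obtain ⟨N, hN, hNy⟩ := (h𝒯X i y).1 hyi
      rw [Finset.mem_compl, hA, Finset.mem_filter] at hi
      by_contra hcon
      refine hi ⟨Finset.mem_univ _, N, hN, fun K hK hKav => hcon ⟨K, ?_, hKav, hNy.mono hK⟩⟩
      exact (Finset.card_le_card hK).trans (h𝒯 i N hN).1
    have hbound := card_exists_isAvoided_le hB hd hε0 hε1 hκ1 hκL hη0 hηstep hHG hHK
    rw [Fintype.card_fin] at hbound
    refine hbound.trans (mul_le_mul_of_nonneg_right ?_ (by positivity))
    have hterm : ∀ k ∈ Finset.range (d + 1), d * κ ^ k * η k ≤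
        d * (((n : ℝ) ^ 3)⁻¹ * (2 * d * κ) ^ d) := by
      intro k hk
      have hkd : k ≤ d := Nat.lt_succ_iff.1 (Finset.mem_range.1 hk)
      rw [hη, mul_assoc]
      have h1 : κ ^ k ≤ (2 * d * κ) ^ k :=
        pow_le_pow_left₀ (by linarith) (le_mul_of_one_le_left (by linarith) (by linarith)) k
      calc d * (κ ^ k * (((n : ℝ) ^ 3)⁻¹ * (2 * d * κ) ^ (d - k)))
          ≤ d * ((2 * d * κ) ^ k * (((n : ℝ) ^ 3)⁻¹ * (2 * d * κ) ^ (d - k))) := by gcongr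
        _ = d * (((n : ℝ) ^ 3)⁻¹ * ((2 * d * κ) ^ k * (2 * d * κ) ^ (d - k))) := by ring
        _ = _ := by rw [← pow_add, Nat.add_sub_cancel' hkd]
    have hmass := total_mass_le hB2 hB0 hn hd ht h
    rw [← hκ] at hmass
    calc ∑ k ∈ Finset.range (d + 1), d * κ ^ k * η k
        ≤ ∑ _k ∈ Finset.range (d + 1), d * (((n : ℝ) ^ 3)⁻¹ * (2 * d * κ) ^ d) :=
          Finset.sum_le_sum hterm
      _ = (d + 1) * d * (2 * d * κ) ^ d * ((n : ℝ) ^ 3)⁻¹ := by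
          rw [Finset.sum_const, Finset.card_range, nsmul_eq_mul]; push_cast; ring
      _ ≤ (n : ℝ) ^ 2 / 2 * ((n : ℝ) ^ 3)⁻¹ := by
          have h1 : ((d : ℝ) + 1) * d ≤ (2 * d) ^ 2 / 2 := by nlinarith
          have h2 : 0 ≤ (2 * d * κ) ^ d := by positivity
          have h3 := mul_le_mul_of_nonneg_right h1 h2
          gcongr
          linarith
      _ = 1 / (2 * (n : ℝ)) := by field_simp

theorem mainTheorem3 :
    (∃ B : ℝ, IsRobustSunflowerConstant B) ∧
    ∀ B : ℝ, IsRobustSunflowerConstant B →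
      ∀ (m n s d t : ℕ) (α : ℕ → ℝ)
        (X : (Fin m → Bool) → (Fin n → Bool)) (F : PMF (Fin n → Bool)),
        2 ≤ n → 1 ≤ d → 1 ≤ t → t ≤ n →
        (∀ i : Fin n, ComputedByDNF s d (fun y => X y i)) →
        (∀ T : Finset (Fin n), (n : ℝ) / 2 ≤ (T.card : ℝ) →
          prob F {x | ∀ i ∈ T, x i = false} ≤ α n) →
        prob F {x | t < hammingWeight x} ≤ α n →
        2 * (d : ℝ) * (t : ℝ) * (40 * B * (t : ℝ) * Real.log (n : ℝ)) ^ d ≤ (n : ℝ) →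
        1 - 2 * α n - 1 / (2 * (n : ℝ)) ≤ statDist (sourceLaw X) F := by
  classical
  refine ⟨exists_isRobustSunflowerConstant, ?_⟩
  intro B hB m n s d t α X F hn hd ht _ hX hF₀ hFt h
  obtain ⟨T, hT, hcard⟩ := exists_half_vanishing hB hn hd ht hX h
  set E : Set (Fin n → Bool) := {x | t < hammingWeight x} ∪ {x | ∀ i ∈ T, x i = false} with hE
  have hFE : prob F E ≤ 2 * α n := by
    have := prob_union_le F {x | t < hammingWeight x} {x | ∀ i ∈ T, x i = false}
    have := hF₀ T hT
    rw [hE]; linarith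
  have hXE : 1 - 1 / (2 * (n : ℝ)) ≤ prob (sourceLaw X) E := by
    rw [prob_sourceLaw, le_div_iff₀ (by positivity)]
    have h1 := Finset.card_filter_add_card_filter_not (s := (Finset.univ : Finset (Fin m → Bool)))
      (fun y => X y ∈ E)
    have h2 : (Finset.univ.filter fun y => ¬ X y ∈ E) =
        Finset.univ.filter fun y => hammingWeight (X y) ≤ t ∧ ∃ i ∈ T, X y i = true := by
      ext y
      simp [hE]
    rw [h2, Finset.card_univ, Fintype.card_fun, Fintype.card_bool, Fintype.card_fin] at h1
    have h3 : ((Finset.univ.filter fun y => X y ∈ E).card : ℝ) +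
        ((Finset.univ.filter fun y =>
          hammingWeight (X y) ≤ t ∧ ∃ i ∈ T, X y i = true).card : ℝ) = 2 ^ m := by
      exact_mod_cast h1
    linarith
  have := prob_sub_prob_le_statDist (sourceLaw X) F E
  linarith
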